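/- **Setting.** Let $Y$ be a real outcome, $R\in\{0,1\}$ the indicator that $Y$ is observed, $X\in\mathbb R^d$ a vector of covariates, and let $(R_iY_i,X_i,R_i)$, $i\ge 1$, be i.i.d. copies of $(RY,X,R)$. Expectations are with respect to the true law. Let $r:\mathbb R^d\to\mathbb R^m$ be a known function, $f(y\mid x;\xi)$, $\xi\in\mathbb R^p$, a family of conditional densities or mass functions with respect to a $\sigma$-finite measure $dy$, and let $\Theta\subset\mathbb R^{m+p+2}$ be the parameter space of $\theta=(\alpha,\beta,\gamma,\xi)$, $\alpha,\gamma\in\mathbb R$, $\beta\in\mathbb R^m$. Put $$\pi_0(x,y;\alpha,\beta,\gamma)=\frac1{1+\exp\{\alpha+\beta^\top r(x)+\gamma y\}},\qquad \pi(x;\theta)=\frac{1}{1+\exp\{\alpha+\beta^\top r(x)+c(x;\gamma,\xi)\}},$$ $$c(x;\gamma,\xi)=\log\int e^{\gamma y}f(y\mid x;\xi)\,dy,\qquad L(y,x,r;\theta)=\{f(y\mid x;\xi)\pi(x;\theta)\}^r\{1-\pi(x;\theta)\}^{1-r},\qquad \ell=\log L,$$ $$\psi=\frac{\partial \ell}{\partial\theta},\qquad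 H(x,r;\theta)=\{r-\pi(x;\theta)\}^2-\pi(x;\theta)\{1-\pi(x;\theta)\},$$ where for $\theta\in\Theta$ and almost every $x$ the integral defining $c$ is finite. Let $\theta^*$ be a maximizer over $\Theta$ of $\theta\mapsto \mathbb E\,\ell(Y,X,R;\theta)\in[-\infty,\infty)$, and let $\hat\theta_n$ be a (measurable) maximizer over $\Theta$ of $\sum_{i=1}^n\ell(Y_i,X_i,R_i;\theta)$. Put $Z=(H,\psi^\top)^\top$ at $\theta^*$, $$J=-\mathbb E\frac{\partial^2\ell(Y,X,R;\theta^*)}{\partial\theta\,\partial\theta^\top},\quad \Sigma=\operatorname{Var}Z,\quad h=\mathbb E\frac{\partial H(X,R;\theta^*)}{\partial\theta},\quad \Delta=\mathbb E\,H(X,R;\theta^*),\quad T_n=\frac1{\sqrt n}\sum_{i=1}^nH(X_i,R_i;\hat\theta_n).$$ The null hypothesis $H_0$ is that $\Pr(R=1\mid X,Y)=\pi_0(X,Y;\alpha,\beta,\gamma)$ almost surely for some $(\alpha,\beta,\gamma)$, the true parameter $\theta_0$ (with $\xi$ a parameter of the true outcome density, see (A2)) lying in $\Theta$. **Assumptions.**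 (A1) Some sub-vector of $X$ is an instrumental variable: given the remaining covariates it does not affect $\Pr(R=1\mid X,Y)$ but it affects the distribution of $Y$; and, if $H_0$ holds, the parameter is identifiable: if $\theta\in\Theta$ gives, for almost every $x$, the same conditional law of $(RY,R)$ given $X=x$ as the true $\theta_0$, then $\theta=\theta_0$. (A2) The conditional density of $Y$ given $X=x$, $R=1$ is $f(y\mid x;\xi_0)$ for some $\xi_0\in\mathbb R^p$. (C1) If $H_0$ fails, $\theta^*$ is the unique maximizer of $\mathbb E\,\ell(Y,X,R;\theta)$ over $\Theta$. (C2) $\Theta$ is compact and $\theta^*$ lies in its interior. (C3) For almost every $x$, for $r=0$ and, at the attainable $y$, for $r=1$, the function $\theta\mapsto\ell(y,x,r;\theta)$ is finite and continuous on $\Theta$ and $C^3$ in its interior. (C4) $\mathbb E|\log L_t(Y,X,R)|<\infty$, where $L_t$ is the true likelihood of $(RY,R)$ given $X$; and for all sufficiently small $\rho>0$ and all $\theta\in\Theta$, $\mathbb E\log\{1+\sup_{\theta'\in\Theta,\|\theta'-\theta\|<\rho}L(Y,X,R;\theta')\}<\infty$. (C5) $J$ exists and has full rank; $\Sigma$ exists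 (all entries of $Z$ are square integrable) and is positive definite. (C6) $h$ exists and is finite. (C7) For any three components $\theta_1,\theta_2,\theta_3$ of $\theta$ there are $\epsilon>0$ and a function $M$ with $\mathbb E M(Y,X,R)<\infty$ that, almost surely, dominates $|\partial^3\ell/\partial\theta_1\partial\theta_2\partial\theta_3|$ and $|\partial^2H/\partial\theta_1\partial\theta_2|$ on $\|\theta-\theta^*\|\le\epsilon$. **Theorem.** Under (A1), (A2) and (C1)–(C7), whether or not $H_0$ holds, as $n\to\infty$, $$T_n-\sqrt n\,\Delta\ \xrightarrow{d}\ \mathcal N(0,\sigma^2),\qquad \sigma^2=(1,h^\top J^{-1})\,\Sigma\,(1,h^\top J^{-1})^\top .$$ -/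

import Mathlib

open MeasureTheory ProbabilityTheory Filter Topology
open scoped ENNReal

noncomputable section

namespace NonignorableGOF

/-- Index set of the coordinates of `θ = (α, β, γ, ξ) ∈ ℝ^{1 + m + 1 + p}`. -/
abbrev Idx (m p : ℕ) : Type := Unit ⊕ (Fin m ⊕ (Unit ⊕ Fin p))

/-- The parameter vectors `θ = (α, β, γ, ξ)`, with the Euclidean norm. -/
abbrev Param (m p : ℕ) : Type := EuclideanSpace ℝ (Idx m p)

namespace Param

variable {m p : ℕ}

/-- The component `α` of `θ`. -/
def α (θ : Param m p) : ℝ := θ (Sum.inl ())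

/-- The component `β` of `θ`. -/
def β (θ : Param m p) : Fin m → ℝ := fun j => θ (Sum.inr (Sum.inl j))

/-- The component `γ` of `θ`. -/
def γ (θ : Param m p) : ℝ := θ (Sum.inr (Sum.inr (Sum.inl ())))

/-- The component `ξ` of `θ`. -/
def ξ (θ : Param m p) : Fin p → ℝ := fun k => θ (Sum.inr (Sum.inr (Sum.inr k)))

end Param

/-- Partial derivative of `g` with respect to the `i`-th coordinate of `θ`. -/
def pd {m p : ℕ} (i : Idx m p) (g : Param m p → ℝ) : Param m p → ℝ :=
  fun θ => fderiv ℝ g θ (EuclideanSpace.single i 1)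

/-- An observation `(y, x, r)`; here `y` stands for the value of `R Y`. -/
abbrev Obs (d : ℕ) : Type := ℝ × (Fin d → ℝ) × ℝ

/-- The ingredients of the working model: the known covariate function `r(x) ∈ ℝ^m`, the measure
`dy` on the outcome space (Lebesgue measure for densities, a counting measure for mass functions),
and the family `f(y | x; ξ)`. -/
structure Model (d m p : ℕ) where
  /-- The known function `r(x)`. -/
  rfun : (Fin d → ℝ) → Fin m → ℝ
  measurable_rfun : Measurable rfun
  /-- The dominating measure for the outcome. -/
  ν : Measure ℝ
  sigmaFinite : SigmaFinite ν
  /-- The family `f y x ξ = f(y | x; ξ)`. -/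
  f : ℝ → (Fin d → ℝ) → (Fin p → ℝ) → ℝ
  measurable_f : ∀ ξ, Measurable (fun z : ℝ × (Fin d → ℝ) => f z.1 z.2 ξ)
  f_nonneg : ∀ y x ξ, 0 ≤ f y x ξ

namespace Model

variable {d m p : ℕ} (𝓜 : Model d m p)

/-- `π₀(x, y; α, β, γ) = 1 / (1 + exp (α + βᵀ r(x) + γ y))`. -/
def propensity (x : Fin d → ℝ) (y : ℝ) (α : ℝ) (β : Fin m → ℝ) (γ : ℝ) : ℝ :=
  1 / (1 + Real.exp (α + ∑ j, β j * 𝓜.rfun x j + γ * y))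

/-- `c(x; γ, ξ) = log ∫ exp (γ y) f(y | x; ξ) dy`. -/
def c (x : Fin d → ℝ) (γ : ℝ) (ξ : Fin p → ℝ) : ℝ :=
  Real.log (∫ y, Real.exp (γ * y) * 𝓜.f y x ξ ∂𝓜.ν)

/-- The marginal propensity `π(x; θ) = 1 / (1 + exp (α + βᵀ r(x) + c(x; γ, ξ)))`. -/
def marginal (x : Fin d → ℝ) (θ : Param m p) : ℝ :=
  1 / (1 + Real.exp (θ.α + ∑ j, θ.β j * 𝓜.rfun x j + 𝓜.c x θ.γ θ.ξ))

/-- The likelihood contribution `L(y, x, r; θ) = (f(y|x;ξ) π(x;θ))^r (1 - π(x;θ))^{1-r}`. -/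
def lik (o : Obs d) (θ : Param m p) : ℝ :=
  (𝓜.f o.1 o.2.1 θ.ξ * 𝓜.marginal o.2.1 θ) ^ o.2.2 * (1 - 𝓜.marginal o.2.1 θ) ^ (1 - o.2.2)

/-- The log-likelihood contribution `ℓ(y, x, r; θ)`. -/
def logLik (o : Obs d) (θ : Param m p) : ℝ :=
  o.2.2 * Real.log (𝓜.f o.1 o.2.1 θ.ξ) + o.2.2 * Real.log (𝓜.marginal o.2.1 θ)
    + (1 - o.2.2) * Real.log (1 - 𝓜.marginal o.2.1 θ)

/-- `sup { L(y, x, r; θ') : θ' ∈ Θ, ‖θ' - θ‖ < ρ }`, as an extended nonnegative number. -/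
def supLik (Θ : Set (Param m p)) (o : Obs d) (θ : Param m p) (ρ : ℝ) : ℝ≥0∞ :=
  ⨆ θ' ∈ Θ ∩ Metric.ball θ ρ, ENNReal.ofReal (𝓜.lik o θ')

/-- The expected log-likelihood `E ℓ(Y, X, R; θ) ∈ [-∞, ∞]`, as the difference of the integrals of
the positive and the negative part, when `Q` is the law of an observation. -/
def expLogLik (Q : Measure (Obs d)) (θ : Param m p) : EReal :=
  ((∫⁻ o, ENNReal.ofReal (𝓜.logLik o θ) ∂Q : ℝ≥0∞) : EReal)
    - ((∫⁻ o, ENNReal.ofReal (-𝓜.logLik o θ) ∂Q : ℝ≥0∞) : EReal)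

/-- `H(x, r; θ) = (r - π(x;θ))² - π(x;θ) (1 - π(x;θ))`. -/
def H (o : Obs d) (θ : Param m p) : ℝ :=
  (o.2.2 - 𝓜.marginal o.2.1 θ) ^ 2 - 𝓜.marginal o.2.1 θ * (1 - 𝓜.marginal o.2.1 θ)

/-- The vector `Z = (H, ψ)`, where `ψ = ∂ℓ/∂θ`. -/
def Z (θ : Param m p) : Unit ⊕ Idx m p → Obs d → ℝ
  | Sum.inl _, o => 𝓜.H o θ
  | Sum.inr j, o => pd j (𝓜.logLik o) θ

/-- `J = - E ∂²ℓ/∂θ∂θᵀ`. -/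
def J (Q : Measure (Obs d)) (θ : Param m p) : Matrix (Idx m p) (Idx m p) ℝ :=
  fun i j => -∫ o, pd i (pd j (𝓜.logLik o)) θ ∂Q

/-- `Σ = Var Z`. -/
def Sig (Q : Measure (Obs d)) (θ : Param m p) :
    Matrix (Unit ⊕ Idx m p) (Unit ⊕ Idx m p) ℝ :=
  fun a b => covariance (𝓜.Z θ a) (𝓜.Z θ b) Q

/-- `h = E ∂H/∂θ`. -/
def h (Q : Measure (Obs d)) (θ : Param m p) : Idx m p → ℝ :=
  fun j => ∫ o, pd j (𝓜.H o) θ ∂Q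

/-- The row vector `(1, hᵀ J⁻¹)`. -/
def influence (Q : Measure (Obs d)) (θ : Param m p) : Unit ⊕ Idx m p → ℝ :=
  Sum.elim (fun _ => 1) (Matrix.vecMul (𝓜.h Q θ) (𝓜.J Q θ)⁻¹)

/-- `σ² = (1, hᵀ J⁻¹) Σ (1, hᵀ J⁻¹)ᵀ`. -/
def sigmaSq (Q : Measure (Obs d)) (θ : Param m p) : ℝ :=
  𝓜.influence Q θ ⬝ᵥ Matrix.mulVec (𝓜.Sig Q θ) (𝓜.influence Q θ)

/-- `Δ = E H(X, R; θ)`. -/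
def Delta (Q : Measure (Obs d)) (θ : Param m p) : ℝ := ∫ o, 𝓜.H o θ ∂Q

/-- The full-sample log-likelihood `ℓ_n(θ)` of the first `n` observations. -/
def logLikSum (obs : ℕ → Obs d) (n : ℕ) (θ : Param m p) : ℝ :=
  ∑ i ∈ Finset.range n, 𝓜.logLik (obs i) θ

/-- The statistic `n^{-1/2} ∑_{i<n} H(X_i, R_i; θ)`; at `θ = θ̂_n` it is `T_n`. -/
def T (obs : ℕ → Obs d) (n : ℕ) (θ : Param m p) : ℝ :=
  1 / Real.sqrt n * ∑ i ∈ Finset.range n, 𝓜.H (obs i) θ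

/-- `θ` and `θ'` determine the same conditional law of `(R Y, R)` given `X = x`, for almost every
`x` with respect to the law of `X`. -/
def SameLaw (Q : Measure (Obs d)) (θ θ' : Param m p) : Prop :=
  ∀ᵐ o ∂Q, 𝓜.marginal o.2.1 θ = 𝓜.marginal o.2.1 θ' ∧
    ∀ᵐ y ∂𝓜.ν, 𝓜.f y o.2.1 θ.ξ = 𝓜.f y o.2.1 θ'.ξ

variable {Ω : Type*} [MeasurableSpace Ω]

/-- The conditional density (or mass function) of `Y` given `X = x` and `R = 1` is `f(· | x; ξ)`:
on the event `R = 1`, the pair `(X, Y)` has density `f(y | x; ξ)` with respect to the product of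
the law of `X` on that event and `dy`. -/
def IsOutcomeDensity (P : Measure Ω) (Y : Ω → ℝ) (X : Ω → Fin d → ℝ) (R : Ω → ℝ)
    (ξ : Fin p → ℝ) : Prop :=
  (P.restrict {ω | R ω = 1}).map (fun ω => (X ω, Y ω)) =
    (((P.restrict {ω | R ω = 1}).map X).prod 𝓜.ν).withDensity
      (fun z => ENNReal.ofReal (𝓜.f z.2 z.1 ξ))

/-- The null model is correct at `θ`: `Pr(R = 1 | X, Y)` is `π₀(X, Y; α, β, γ)`, and `f(· | x; ξ)`
is the conditional density of `Y` given `X = x`, `R = 1`. -/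
structure NullAt (P : Measure Ω) (Y : Ω → ℝ) (X : Ω → Fin d → ℝ) (R : Ω → ℝ)
    (θ : Param m p) : Prop where
  propensity_eq :
    P[R | MeasurableSpace.comap (fun ω => (X ω, Y ω)) inferInstance]
      =ᵐ[P] fun ω => 𝓜.propensity (X ω) (Y ω) θ.α θ.β θ.γ
  outcome : 𝓜.IsOutcomeDensity P Y X R θ.ξ

/-- The value `L_t(Y, X, R)` of the true likelihood contribution, when the outcome density
given `X` and `R = 1` is `f(· | x; ξ₀)`. -/
def trueLik (P : Measure Ω) (Y : Ω → ℝ) (X : Ω → Fin d → ℝ) (R : Ω → ℝ)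
    (ξ₀ : Fin p → ℝ) (ω : Ω) : ℝ :=
  (𝓜.f (Y ω) (X ω) ξ₀ * (P[R | MeasurableSpace.comap X inferInstance]) ω) ^ R ω
    * (1 - (P[R | MeasurableSpace.comap X inferInstance]) ω) ^ (1 - R ω)

end Model

/-- The sub-vector of the covariates with coordinates in `S` is an instrument: given the other
covariates, it does not affect the missingness mechanism `Pr(R = 1 | X, Y)`, but it affects the
distribution of `Y`. -/
structure IsInstrument {d : ℕ} {Ω : Type*} [MeasurableSpace Ω] (P : Measure Ω)
    (Y : Ω → ℝ) (X : Ω → Fin d → ℝ) (R : Ω → ℝ) (S : Set (Fin d)) : Prop where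
  missingness :
    P[R | MeasurableSpace.comap (fun ω => (X ω, Y ω)) inferInstance] =ᵐ[P]
      P[R | MeasurableSpace.comap
        (fun ω => ((fun j : (Sᶜ : Set (Fin d)) => X ω j), Y ω)) inferInstance]
  relevance : ∃ A : Set ℝ, MeasurableSet A ∧
    ¬ (P[(Y ⁻¹' A).indicator (fun _ => (1 : ℝ)) | MeasurableSpace.comap X inferInstance] =ᵐ[P]
      P[(Y ⁻¹' A).indicator (fun _ => (1 : ℝ)) | MeasurableSpace.comap
        (fun ω => (fun j : (Sᶜ : Set (Fin d)) => X ω j)) inferInstance])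

/-- The law of the observation `(R Y, X, R)`. -/
def obsLaw {d : ℕ} {Ω : Type*} [MeasurableSpace Ω] (P : Measure Ω)
    (Y : Ω → ℝ) (X : Ω → Fin d → ℝ) (R : Ω → ℝ) : Measure (Obs d) :=
  P.map (fun ω => (R ω * Y ω, X ω, R ω))

/-- An instrument exists, and the parameter of the null model is identifiable whenever the null
model is correct at some point of the parameter space. -/
structure Assumption1 {d m p : ℕ} {Ω : Type*} [MeasurableSpace Ω] (𝓜 : Model d m p)
    (Θ : Set (Param m p)) (P : Measure Ω) (Y : Ω → ℝ) (X : Ω → Fin d → ℝ) (R : Ω → ℝ) :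
    Prop where
  instrument : ∃ S : Set (Fin d), IsInstrument P Y X R S
  identifiable : ∀ θ₀ ∈ Θ, 𝓜.NullAt P Y X R θ₀ →
    ∀ θ ∈ Θ, 𝓜.SameLaw (obsLaw P Y X R) θ θ₀ → θ = θ₀

/-- For every parameter value, `f(· | x; ξ)` is a probability density and `c(x; γ, ξ)` is finite,
for almost every `x`. -/
structure WellDefined {d m p : ℕ} (𝓜 : Model d m p) (Θ : Set (Param m p))
    (Q : Measure (Obs d)) : Prop where
  density : ∀ᵐ o ∂Q, ∀ θ ∈ Θ, ∫⁻ y, ENNReal.ofReal (𝓜.f y o.2.1 θ.ξ) ∂𝓜.ν = 1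
  mgf : ∀ᵐ o ∂Q, ∀ θ ∈ Θ,
    Integrable (fun y => Real.exp (θ.γ * y) * 𝓜.f y o.2.1 θ.ξ) 𝓜.ν

/-- The regularity conditions. -/
structure Regularity {d m p : ℕ} {Ω : Type*} [MeasurableSpace Ω] (𝓜 : Model d m p)
    (Θ : Set (Param m p)) (P : Measure Ω) (Y : Ω → ℝ) (X : Ω → Fin d → ℝ) (R : Ω → ℝ)
    (ξ₀ : Fin p → ℝ) (θs : Param m p) : Prop where
  /-- Under the alternative, `θ*` is the unique maximizer of the expected log-likelihood. -/
  unique_max : (¬ ∃ θ₀ ∈ Θ, 𝓜.NullAt P Y X R θ₀) →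
    ∀ θ ∈ Θ, θ ≠ θs → 𝓜.expLogLik (obsLaw P Y X R) θ < 𝓜.expLogLik (obsLaw P Y X R) θs
  param_compact : IsCompact Θ
  param_interior : θs ∈ interior Θ
  /-- `ℓ(y, x, r; ·)` is finite, continuous on `Θ` and three times continuously differentiable in
  its interior, for `r = 0` and, at the observed outcomes, for `r = 1`. -/
  smooth : ∀ᵐ o ∂(obsLaw P Y X R), ∀ r : ℝ, (r = 0 ∨ r = o.2.2) →
    (∀ θ ∈ Θ, 0 < 𝓜.lik (o.1, o.2.1, r) θ) ∧
    ContinuousOn (𝓜.logLik (o.1, o.2.1, r)) Θ ∧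
    ContDiffOn ℝ 3 (𝓜.logLik (o.1, o.2.1, r)) (interior Θ)
  log_trueLik : Integrable (fun ω => Real.log (𝓜.trueLik P Y X R ξ₀ ω)) P
  log_supLik : ∀ᶠ ρ : ℝ in 𝓝[>] 0, ∀ θ ∈ Θ,
    ∫⁻ o, (ENNReal.log (1 + 𝓜.supLik Θ o θ ρ)).toENNReal ∂(obsLaw P Y X R) < ⊤
  /-- The matrix `J` exists and has full rank. -/
  J_exists : ∀ i j : Idx m p,
    Integrable (fun o => pd i (pd j (𝓜.logLik o)) θs) (obsLaw P Y X R)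
  J_full_rank : IsUnit (𝓜.J (obsLaw P Y X R) θs).det
  /-- The covariance matrix `Σ` exists and is positive definite. -/
  Sig_exists : ∀ a, MemLp (𝓜.Z θs a) 2 (obsLaw P Y X R)
  Sig_posDef : (𝓜.Sig (obsLaw P Y X R) θs).PosDef
  /-- The vector `h` exists. -/
  h_exists : ∀ j : Idx m p, Integrable (fun o => pd j (𝓜.H o) θs) (obsLaw P Y X R)
  /-- Third derivatives of `ℓ` and second derivatives of `H` are dominated near `θ*`. -/
  dominated : ∀ i j k : Idx m p, ∃ ε : ℝ, 0 < ε ∧ ∃ M : Obs d → ℝ,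
    (∀ᵐ o ∂(obsLaw P Y X R), ∀ θ, ‖θ - θs‖ ≤ ε →
      |pd i (pd j (pd k (𝓜.logLik o))) θ| ≤ M o ∧ |pd i (pd j (𝓜.H o)) θ| ≤ M o) ∧
    Integrable M (obsLaw P Y X R)

end NonignorableGOF

end

/-! Put V = θ̂ₙ − θ* and let bars denote sample averages. Near θ* the score equation reads ψ̄ +
V·(average Hessian) = O(|V|²), while H̄(θ̂ₙ) − H̄(θ*) = V·(average ∂H) + O(|V|²). Since V → 0 almost
surely, the strong law and invertibility of J solve the first relation for V, and substitution shows
that T_n is governed by the average of the single function H + hᵀJ⁻¹ψ. The central limit theorem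
applies to that function, and symmetry of J turns its variance into σ². No separate tightness of √n
V is needed: the error is almost surely o(Σ|ψ̄ₖ|) (`isLittleO_linearization`), and √n ψ̄ is bounded
in L² (`tendstoInMeasure_zero_of_le_mul`). Even E ψ = 0 comes from the expansion, without
differentiating under the integral (`IsSample.tendstoInDistribution_plugin`).

Consistency is Wald's argument: each θ ≠ θ* has a neighbourhood on which ℓ has an integrable
majorant of mean below E ℓ(θ*) (`exists_local_majorant`), and finitely many such neighbourhoods
cover Θ minus a ball about θ* (`IsSample.tendsto_of_isMaxOn`).

This requires E ℓ(θ*) to be finite and the maximizer to be unique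
(`Regularity.integrable_and_unique_max`). Off the null, uniqueness is assumed. Under the null,
averaging 1/π₀ over the respondents' outcome density gives 1/π, so L(θ₀) is the true likelihood and
likelihood ratios against it have mean at most one. The information inequality then makes any
competitor as good as θ₀ yield the same conditional law, and identifiability concludes. -/

namespace NonignorableGOF

/-! ### Limit theorems and second moments for functions of an i.i.d. sample -/

section Sampling

variable {Ω 𝓞 : Type*} [MeasurableSpace Ω] [MeasurableSpace 𝓞] {P : Measure Ω} {Q : Measure 𝓞}
  {ξ : ℕ → Ω → 𝓞}

/-- An i.i.d. sequence of observations with law `Q`. -/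
structure IsSample (P : Measure Ω) (Q : Measure 𝓞) (ξ : ℕ → Ω → 𝓞) : Prop where
  indep : iIndepFun ξ P
  aemeasurable : ∀ i, AEMeasurable (ξ i) P
  law : ∀ i, P.map (ξ i) = Q

namespace IsSample

theorem ae (hξ : IsSample P Q ξ) {p : 𝓞 → Prop} (hp : ∀ᵐ o ∂Q, p o) :
    ∀ᵐ ω ∂P, ∀ i, p (ξ i ω) := by
  refine ae_all_iff.2 fun i => ?_
  have := hξ.law i ▸ hp
  exact ae_of_ae_map (hξ.aemeasurable i) this

theorem aemeasurable_comp (hξ : IsSample P Q ξ) {g : 𝓞 → ℝ} (hg : AEMeasurable g Q) (i : ℕ) :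
    AEMeasurable (fun ω => g (ξ i ω)) P := by
  have := hξ.law i ▸ hg
  exact this.comp_aemeasurable (hξ.aemeasurable i)

theorem integrable_comp (hξ : IsSample P Q ξ) {g : 𝓞 → ℝ} (hg : Integrable g Q) (i : ℕ) :
    Integrable (fun ω => g (ξ i ω)) P := by
  have := hξ.law i ▸ hg
  exact this.comp_aemeasurable (hξ.aemeasurable i)

theorem memLp_comp (hξ : IsSample P Q ξ) {g : 𝓞 → ℝ} (hg : MemLp g 2 Q) (i : ℕ) :
    MemLp (fun ω => g (ξ i ω)) 2 P := by
  have h := hg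
  rw [← hξ.law i] at h
  exact h.comp_of_map (hξ.aemeasurable i)

theorem integral_comp (hξ : IsSample P Q ξ) {g : 𝓞 → ℝ} (hg : AEStronglyMeasurable g Q) (i : ℕ) :
    ∫ ω, g (ξ i ω) ∂P = ∫ o, g o ∂Q := by
  have h := hg
  rw [← hξ.law i] at h ⊢
  exact (integral_map (hξ.aemeasurable i) h).symm

theorem variance_comp (hξ : IsSample P Q ξ) {g : 𝓞 → ℝ} (hg : AEMeasurable g Q) (i : ℕ) :
    Var[fun ω => g (ξ i ω); P] = Var[g; Q] := by
  have h := hg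
  rw [← hξ.law i] at h ⊢
  exact (variance_map h (hξ.aemeasurable i)).symm

theorem iIndepFun_comp (hξ : IsSample P Q ξ) {g : 𝓞 → ℝ} (hg : AEMeasurable g Q) :
    iIndepFun (fun i ω => g (ξ i ω)) P :=
  hξ.indep.comp₀ (fun _ => g) hξ.aemeasurable fun i => by rw [hξ.law i]; exact hg

theorem identDistrib_comp (hξ : IsSample P Q ξ) {g : 𝓞 → ℝ} (hg : AEMeasurable g Q) (i : ℕ) :
    IdentDistrib (fun ω => g (ξ i ω)) (fun ω => g (ξ 0 ω)) P P := by
  have h : IdentDistrib (ξ i) (ξ 0) P P :=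
    ⟨hξ.aemeasurable i, hξ.aemeasurable 0, by rw [hξ.law, hξ.law]⟩
  exact h.comp_of_aemeasurable (u := g) (by rw [hξ.law i]; exact hg)

theorem strong_law (hξ : IsSample P Q ξ) {g : 𝓞 → ℝ} (hg : Integrable g Q) :
    ∀ᵐ ω ∂P, Tendsto (fun n : ℕ => (∑ i ∈ Finset.range n, g (ξ i ω)) / n) atTop
      (𝓝 (∫ o, g o ∂Q)) := by
  have h := strong_law_ae_real (fun i ω => g (ξ i ω)) (hξ.integrable_comp hg 0)
    (fun i j hij => (hξ.iIndepFun_comp hg.1.aemeasurable).indepFun hij)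
    (hξ.identDistrib_comp hg.1.aemeasurable)
  rw [hξ.integral_comp hg.1] at h
  exact h

theorem central_limit [IsProbabilityMeasure P] (hξ : IsSample P Q ξ) {g : 𝓞 → ℝ}
    (hg : MemLp g 2 Q) :
    TendstoInDistribution
      (fun (n : ℕ) ω => (√n)⁻¹ * (∑ i ∈ Finset.range n, g (ξ i ω) - n * ∫ o, g o ∂Q))
      atTop (id : ℝ → ℝ) (fun _ => P) (gaussianReal 0 Var[g; Q].toNNReal) := by
  have hm := hg.1.aemeasurable
  have hv := hξ.variance_comp hm 0
  have hi := hξ.integral_comp hg.1 0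
  have hX := hξ.memLp_comp hg 0
  have hind := hξ.iIndepFun_comp hm
  have hid := hξ.identDistrib_comp hm
  generalize Var[g; Q] = v at *
  generalize ∫ o, g o ∂Q = c at *
  subst hv hi
  exact tendstoInDistribution_inv_sqrt_mul_sum_sub (X := fun i ω => g (ξ i ω)) HasLaw.id hX hind hid

theorem variance_sum_comp [IsProbabilityMeasure P] (hξ : IsSample P Q ξ) {g : 𝓞 → ℝ}
    (hg : MemLp g 2 Q) (n : ℕ) :
    Var[fun ω => ∑ i ∈ Finset.range n, g (ξ i ω); P] = n * Var[g; Q] := by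
  have hm := hg.1.aemeasurable
  have h := IndepFun.variance_sum (μ := P) (X := fun i ω => g (ξ i ω)) (s := Finset.range n)
    (fun i _ => hξ.memLp_comp hg i)
    (fun i _ j _ hij => (hξ.iIndepFun_comp hm).indepFun hij)
  have h2 : (∑ i ∈ Finset.range n, fun ω => g (ξ i ω))
      = fun ω => ∑ i ∈ Finset.range n, g (ξ i ω) := by
    ext ω; simp
  rw [h2] at h
  rw [h]
  simp [hξ.variance_comp hm]

theorem integral_sq_sum_comp [IsProbabilityMeasure P] (hξ : IsSample P Q ξ) {g : 𝓞 → ℝ}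
    (hg : MemLp g 2 Q) (h0 : ∫ o, g o ∂Q = 0) (n : ℕ) :
    ∫ ω, (∑ i ∈ Finset.range n, g (ξ i ω)) ^ 2 ∂P = n * Var[g; Q] := by
  rw [← hξ.variance_sum_comp hg n, variance_eq_integral]
  · have : ∫ ω, ∑ i ∈ Finset.range n, g (ξ i ω) ∂P = 0 := by
      rw [integral_finsetSum _ fun i _ => (hξ.memLp_comp hg i).integrable (by norm_num)]
      simp [hξ.integral_comp hg.1, h0]
    simp [this]
  · exact Finset.aemeasurable_fun_sum _ fun i _ => hξ.aemeasurable_comp hg.1.aemeasurable i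

end IsSample

end Sampling

/-! ### Almost sure domination turned into convergence in probability -/

section ConvergenceInProbability

variable {Ω : Type*} [MeasurableSpace Ω] {P : Measure Ω}

/-- If `|D n|` is eventually at most any small multiple of `U n`, and `U` is bounded in `L²`, then
`D n → 0` in probability. -/
theorem tendstoInMeasure_zero_of_le_mul [IsProbabilityMeasure P] {D U : ℕ → Ω → ℝ} {C : ℝ}
    (hD : ∀ n, AEMeasurable (D n) P) (hU : ∀ n, MemLp (U n) 2 P)
    (hUC : ∀ n, ∫ ω, (U n ω) ^ 2 ∂P ≤ C)
    (h : ∀ e > 0, ∀ᵐ ω ∂P, ∀ᶠ n in atTop, |D n ω| ≤ e * U n ω) :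
    TendstoInMeasure P D atTop (fun _ => 0) := by
  rw [tendstoInMeasure_iff_measureReal_norm]
  intro δ hδ
  have hC : 0 ≤ C := (integral_nonneg fun ω => sq_nonneg (U 0 ω)).trans (hUC 0)
  rw [Metric.tendsto_atTop]
  intro η hη
  -- This e makes Markov's inequality for e²U² give P(e|U n| ≥ δ/2) < η/2 for every n at once.
  obtain ⟨e, he, heC⟩ : ∃ e > 0, e ^ 2 * (4 / δ ^ 2) * C < η / 2 := by
    have : Tendsto (fun e : ℝ => e ^ 2 * (4 / δ ^ 2) * C) (𝓝[>] 0) (𝓝 0) := by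
      have : Continuous fun e : ℝ => e ^ 2 * (4 / δ ^ 2) * C := by fun_prop
      simpa using (this.tendsto 0).mono_left nhdsWithin_le_nhds
    obtain ⟨e, h1, h2⟩ := ((this.eventually_lt_const (half_pos hη)).and
      self_mem_nhdsWithin).exists
    exact ⟨e, h2, h1⟩
  have hUm : ∀ n, AEMeasurable (U n) P := fun n => (hU n).1.aemeasurable
  -- The index beyond which |D| ≤ eU depends on ω. The positive part of |D| − eU is eventually zero
  -- on almost every path, hence small in probability.
  let G : ℕ → Ω → ℝ := fun n ω => max (|D n ω| - e * U n ω) 0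
  have hG : TendstoInMeasure P G atTop (fun _ => 0) := by
    refine tendstoInMeasure_of_tendsto_ae (fun n => ?_) ?_
    · have := hD n; have := hUm n
      exact AEMeasurable.aestronglyMeasurable (by fun_prop)
    · filter_upwards [h e he] with ω hω
      refine tendsto_const_nhds.congr' ?_
      filter_upwards [hω] with n hn
      exact (max_eq_right (by linarith)).symm
  rw [tendstoInMeasure_iff_measureReal_norm] at hG
  obtain ⟨N, hN⟩ := Metric.tendsto_atTop.1 (hG (δ / 2) (half_pos hδ)) (η / 2) (half_pos hη)
  refine ⟨N, fun n hn => ?_⟩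
  have h1 := hN n hn
  simp only [dist_zero_right, Real.norm_eq_abs, sub_zero, abs_of_nonneg measureReal_nonneg] at h1 ⊢
  have h2 : P.real {ω | (δ / 2) ^ 2 ≤ e ^ 2 * (U n ω) ^ 2} < η / 2 := by
    have hi : Integrable (fun ω => e ^ 2 * (U n ω) ^ 2) P := (hU n).integrable_sq.const_mul _
    have := mul_meas_ge_le_integral_of_nonneg (μ := P) (f := fun ω => e ^ 2 * (U n ω) ^ 2)
      (ae_of_all _ fun ω => by positivity) hi ((δ / 2) ^ 2)
    rw [integral_const_mul] at this
    have hδ2 : 0 < (δ / 2) ^ 2 := by positivity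
    calc P.real {ω | (δ / 2) ^ 2 ≤ e ^ 2 * (U n ω) ^ 2}
        ≤ e ^ 2 * (4 / δ ^ 2) * ∫ ω, (U n ω) ^ 2 ∂P := by
          rw [← mul_le_mul_iff_right₀ hδ2]
          refine this.trans (le_of_eq ?_)
          field_simp
          ring
      _ ≤ e ^ 2 * (4 / δ ^ 2) * C := by gcongr; exact hUC n
      _ < η / 2 := heC
  have h3 : {ω | δ ≤ |D n ω|} ⊆ {ω | δ / 2 ≤ |G n ω|} ∪ {ω | (δ / 2) ^ 2 ≤ e ^ 2 * (U n ω) ^ 2} := by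
    intro ω hω
    by_contra hcon
    simp only [Set.mem_union, Set.mem_ofPred_eq, not_or, not_le] at hcon hω
    obtain ⟨ha, hb⟩ := hcon
    have ha' : |D n ω| - e * U n ω < δ / 2 :=
      lt_of_le_of_lt ((le_max_left _ _).trans (le_abs_self _)) ha
    rw [← mul_pow] at hb
    have := abs_lt_of_sq_lt_sq hb (by positivity)
    linarith [(abs_lt.1 this).2]
  calc P.real {ω | δ ≤ |D n ω|} ≤ _ := measureReal_mono h3
    _ ≤ _ := measureReal_union_le _ _
    _ < η := by linarith

end ConvergenceInProbability

/-! ### Deterministic asymptotics of the expanded score equation -/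

section Linearization

open Asymptotics Matrix

variable {ι : Type*} [Fintype ι]

theorem tendsto_sum_abs_zero {V : ι → ℕ → ℝ} (hV : ∀ j, Tendsto (V j) atTop (𝓝 0)) :
    Tendsto (fun n => ∑ j, |V j n|) atTop (𝓝 0) := by
  have := tendsto_finsetSum Finset.univ fun j _ => (hV j).abs
  simpa using this

theorem isBigO_sum_abs (V : ι → ℕ → ℝ) (j : ι) :
    V j =O[atTop] fun n => ∑ j, |V j n| := by
  refine IsBigO.of_bound 1 (Eventually.of_forall fun n => ?_)
  rw [one_mul, Real.norm_eq_abs, Real.norm_eq_abs]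
  exact (Finset.single_le_sum (f := fun j => |V j n|) (fun i _ => abs_nonneg _)
    (Finset.mem_univ j)).trans (le_abs_self _)

/-- A quadratic remainder r²m factors as (r m)·r with r m → 0, because m converges. -/
theorem isLittleO_of_le_sq_mul {u r m : ℕ → ℝ} {m₀ : ℝ} (hr : Tendsto r atTop (𝓝 0))
    (hm : Tendsto m atTop (𝓝 m₀)) (h : ∀ᶠ n in atTop, |u n| ≤ r n ^ 2 * m n) :
    u =o[atTop] r := by
  have h1 : u =O[atTop] fun n => (r n * m n) * r n := by
    refine IsBigO.of_bound 1 (h.mono fun n hn => ?_)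
    rw [one_mul, Real.norm_eq_abs, Real.norm_eq_abs]
    refine hn.trans ((le_of_eq ?_).trans (le_abs_self _))
    ring
  refine h1.trans_isLittleO ?_
  have h2 : (fun n => r n * m n) =o[atTop] fun _ => (1 : ℝ) := by
    rw [isLittleO_one_iff]
    simpa using hr.mul hm
  simpa using h2.mul_isBigO (isBigO_refl r atTop)

/-- Random coefficients may be replaced by their limits at a cost negligible against |V|. -/
theorem isLittleO_sum_mul_sub {V b : ι → ℕ → ℝ} {b₀ : ι → ℝ}
    (hb : ∀ j, Tendsto (b j) atTop (𝓝 (b₀ j))) :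
    (fun n => ∑ j, V j n * b j n - ∑ j, V j n * b₀ j) =o[atTop] fun n => ∑ j, |V j n| := by
  simp_rw [← Finset.sum_sub_distrib, ← mul_sub]
  refine IsLittleO.fun_sum fun j _ => ?_
  have h2 : (fun n => b j n - b₀ j) =o[atTop] fun _ => (1 : ℝ) := by
    rw [isLittleO_one_iff]
    simpa using (hb j).sub_const (b₀ j)
  simpa using (isBigO_sum_abs V j).mul_isLittleO h2

/-- The average score tends to zero along a consistent sequence of its approximate roots. -/
theorem tendsto_score_zero {s V : ι → ℕ → ℝ} {B : ι → ι → ℕ → ℝ} {m : ℕ → ℝ}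
    {B₀ : Matrix ι ι ℝ} {m₀ : ℝ} (hV : ∀ j, Tendsto (V j) atTop (𝓝 0))
    (hB : ∀ j k, Tendsto (B j k) atTop (𝓝 (B₀ j k))) (hm : Tendsto m atTop (𝓝 m₀))
    (hs : ∀ᶠ n in atTop, ∀ k, |s k n + ∑ j, V j n * B j k n| ≤ (∑ j, |V j n|) ^ 2 * m n)
    (k : ι) : Tendsto (s k) atTop (𝓝 0) := by
  have hr := tendsto_sum_abs_zero hV
  have h1 := (isLittleO_of_le_sq_mul hr hm (hs.mono fun n hn => hn k)).trans_tendsto hr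
  have h2 : Tendsto (fun n => ∑ j, V j n * B j k n) atTop (𝓝 0) := by
    have := tendsto_finsetSum Finset.univ fun j _ => (hV j).mul (hB j k)
    simpa using this
  simpa using h1.sub h2

/-- With r = Σ|Vⱼ|, the score relation gives V J = s + o(r), hence V = s J⁻¹ + o(r). This forces r =
O(Σ|sₖ|), so every o(r) error, including the one in d = V·h₀ + o(r), becomes o(Σ|sₖ|). -/
theorem isLittleO_linearization [DecidableEq ι] {s V : ι → ℕ → ℝ} {B : ι → ι → ℕ → ℝ}
    {h : ι → ℕ → ℝ} {d m : ℕ → ℝ} {B₀ : Matrix ι ι ℝ} {h₀ : ι → ℝ} {m₀ : ℝ}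
    (hdet : IsUnit (-B₀).det) (hV : ∀ j, Tendsto (V j) atTop (𝓝 0))
    (hB : ∀ j k, Tendsto (B j k) atTop (𝓝 (B₀ j k))) (hm : Tendsto m atTop (𝓝 m₀))
    (hh : ∀ j, Tendsto (h j) atTop (𝓝 (h₀ j)))
    (hs : ∀ᶠ n in atTop, ∀ k, |s k n + ∑ j, V j n * B j k n| ≤ (∑ j, |V j n|) ^ 2 * m n)
    (hd : ∀ᶠ n in atTop, |d n - ∑ j, V j n * h j n| ≤ (∑ j, |V j n|) ^ 2 * m n) :
    (fun n => d n - ∑ k, ((-B₀)⁻¹ *ᵥ h₀) k * s k n) =o[atTop] fun n => ∑ k, |s k n| := by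
  set J : Matrix ι ι ℝ := -B₀ with hJ
  set r : ℕ → ℝ := fun n => ∑ j, |V j n| with hrdef
  have hr : Tendsto r atTop (𝓝 0) := tendsto_sum_abs_zero hV
  -- the score equation, solved for `V`
  have h1 : ∀ k, (fun n => s k n - ∑ j, V j n * J j k) =o[atTop] r := fun k => by
    have e1 := isLittleO_of_le_sq_mul hr hm (hs.mono fun n hn => hn k)
    have e2 := isLittleO_sum_mul_sub (V := V) (fun j => hB j k)
    refine (e1.sub e2).congr_left fun n => ?_
    simp only [hJ, Matrix.neg_apply, mul_neg, Finset.sum_neg_distrib]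
    ring
  have hVJ : ∀ j n, V j n = ∑ k, (∑ i, V i n * J i k) * J⁻¹ k j := fun j n => by
    have : (fun i => V i n) ᵥ* J ᵥ* J⁻¹ = fun i => V i n := by
      rw [Matrix.vecMul_vecMul, Matrix.mul_nonsing_inv _ hdet, Matrix.vecMul_one]
    have := congrFun this j
    simp only [Matrix.vecMul, dotProduct] at this
    exact this.symm
  have h2 : ∀ j, (fun n => V j n - ∑ k, s k n * J⁻¹ k j) =o[atTop] r := fun j => by
    have : (fun n => ∑ k, -(J⁻¹ k j * (s k n - ∑ i, V i n * J i k))) =o[atTop] r :=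
      IsLittleO.fun_sum fun k _ => ((h1 k).const_mul_left _).neg_left
    refine this.congr_left fun n => ?_
    rw [hVJ j n, ← Finset.sum_sub_distrib]
    refine Finset.sum_congr rfl fun k _ => ?_
    ring
  -- Absorption: r ≤ r/2 + C Σ|sₖ| eventually, which is the source of the constant 2C.
  have hrs : r =O[atTop] fun n => ∑ k, |s k n| := by
    have e1 : (fun n => ∑ j, |V j n - ∑ k, s k n * J⁻¹ k j|) =o[atTop] r :=
      IsLittleO.fun_sum fun j _ => (h2 j).abs_left
    have e2 : (fun n => ∑ j, |∑ k, s k n * J⁻¹ k j|) =O[atTop] fun n => ∑ k, |s k n| := by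
      refine IsBigO.fun_sum fun j _ => IsBigO.abs_left (IsBigO.fun_sum fun k _ => ?_)
      have := (isBigO_sum_abs s k).const_mul_left (J⁻¹ k j)
      simpa only [mul_comm] using this
    obtain ⟨C, hC⟩ := e2.bound
    refine IsBigO.of_bound (2 * C) ?_
    filter_upwards [hC, e1.bound (half_pos one_pos)] with n hn1 hn2
    simp only [Real.norm_eq_abs] at hn1 hn2 ⊢
    have hr0 : 0 ≤ r n := Finset.sum_nonneg fun j _ => abs_nonneg _
    rw [abs_of_nonneg hr0] at hn2 ⊢
    have e3 := (le_abs_self _).trans hn1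
    have e4 := (le_abs_self _).trans hn2
    have e5 : r n ≤ (∑ j, |V j n - ∑ k, s k n * J⁻¹ k j|) + ∑ j, |∑ k, s k n * J⁻¹ k j| := by
      rw [← Finset.sum_add_distrib]
      refine Finset.sum_le_sum fun j _ => ?_
      have := abs_add_le (V j n - ∑ k, s k n * J⁻¹ k j) (∑ k, s k n * J⁻¹ k j)
      simpa using this
    linarith
  refine IsLittleO.trans_isBigO ?_ hrs
  have e1 := isLittleO_of_le_sq_mul hr hm hd
  have e2 := isLittleO_sum_mul_sub (V := V) hh
  have e3 : (fun n => ∑ j, h₀ j * (V j n - ∑ k, s k n * J⁻¹ k j)) =o[atTop] r :=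
    IsLittleO.fun_sum fun j _ => (h2 j).const_mul_left _
  refine ((e1.add e2).add e3).congr_left fun n => ?_
  have e4 : ∑ k, (J⁻¹ *ᵥ h₀) k * s k n = ∑ j, h₀ j * ∑ k, s k n * J⁻¹ k j := by
    simp only [Matrix.mulVec, dotProduct, Finset.sum_mul, Finset.mul_sum]
    rw [Finset.sum_comm]
    refine Finset.sum_congr rfl fun j _ => Finset.sum_congr rfl fun k _ => ?_
    ring
  rw [e4]
  simp only [mul_sub, Finset.sum_sub_distrib]
  have e5 : ∑ j, V j n * h₀ j = ∑ j, h₀ j * V j n :=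
    Finset.sum_congr rfl fun j _ => mul_comm _ _
  rw [e5]
  ring

end Linearization

/-! ### Limit law of a plug-in sum at a consistent approximate root -/

section MEstimation

open Matrix

variable {Ω 𝓞 ι : Type*} [MeasurableSpace Ω] [MeasurableSpace 𝓞] [Fintype ι]
  {P : Measure Ω} {Q : Measure 𝓞} {ξ : ℕ → Ω → 𝓞}

theorem sum_div_sq_le {a r m : ℝ} {n : ℕ} (h : |a| ≤ r ^ 2 * m) : |a / n| ≤ r ^ 2 * (m / n) := by
  rw [abs_div, Nat.abs_cast, ← mul_div_assoc]
  gcongr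

theorem div_add_sum_mul_div {ι : Type*} [Fintype ι] (a : ℝ) (v b : ι → ℝ) (n : ℝ) :
    a / n + ∑ j, v j * (b j / n) = (a + ∑ j, v j * b j) / n := by
  rw [add_div, Finset.sum_div]
  simp only [mul_div_assoc]

theorem IsSample.memLp_mean (hξ : IsSample P Q ξ) {g : 𝓞 → ℝ} (hg : MemLp g 2 Q) (n : ℕ) :
    MemLp (fun ω => √(n : ℝ) * |(∑ i ∈ Finset.range n, g (ξ i ω)) / n|) 2 P := by
  have := memLp_finsetSum (Finset.range n) fun i _ => hξ.memLp_comp hg i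
  simp only [div_eq_inv_mul]
  exact (this.const_mul _).abs.const_mul _

theorem IsSample.integral_sq_mean_le [IsProbabilityMeasure P] (hξ : IsSample P Q ξ) {g : 𝓞 → ℝ}
    (hg : MemLp g 2 Q) (h0 : ∫ o, g o ∂Q = 0) (n : ℕ) :
    ∫ ω, (√(n : ℝ) * |(∑ i ∈ Finset.range n, g (ξ i ω)) / n|) ^ 2 ∂P ≤ Var[g; Q] := by
  have e : ∀ ω, (√(n : ℝ) * |(∑ i ∈ Finset.range n, g (ξ i ω)) / n|) ^ 2
      = (n / (n : ℝ) ^ 2) * (∑ i ∈ Finset.range n, g (ξ i ω)) ^ 2 := fun ω => by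
    rw [mul_pow, Real.sq_sqrt (Nat.cast_nonneg n), sq_abs, div_pow]
    ring
  simp_rw [e]
  rw [integral_const_mul, hξ.integral_sq_sum_comp hg h0]
  rcases eq_or_ne n 0 with rfl | hn
  · simp [variance_nonneg g Q]
  · have : (n : ℝ) ≠ 0 := Nat.cast_ne_zero.2 hn
    refine le_of_eq ?_
    field_simp

theorem integral_sq_sum_le {u : ι → Ω → ℝ} {v : ι → ℝ} (hu : ∀ k, MemLp (u k) 2 P)
    (huv : ∀ k, ∫ ω, (u k ω) ^ 2 ∂P ≤ v k) :
    ∫ ω, (∑ k, u k ω) ^ 2 ∂P ≤ Fintype.card ι * ∑ k, v k := by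
  calc ∫ ω, (∑ k, u k ω) ^ 2 ∂P ≤ ∫ ω, Fintype.card ι * ∑ k, (u k ω) ^ 2 ∂P := by
        refine integral_mono (memLp_finsetSum _ fun k _ => hu k).integrable_sq
          ((integrable_finsetSum _ fun k _ => (hu k).integrable_sq).const_mul _) fun ω => ?_
        exact sq_sum_le_card_mul_sum_sq
    _ ≤ _ := by
        rw [integral_const_mul, integral_finsetSum _ fun k _ => (hu k).integrable_sq]
        gcongr with k
        exact huv k

theorem sqrt_normalization {n : ℕ} (hn : 0 < n) (S A B c : ℝ) :
    1 / √(n : ℝ) * S - √(n : ℝ) * c - (√(n : ℝ))⁻¹ * (A + B - n * c)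
      = √(n : ℝ) * ((S - A) / n - B / n) := by
  have hn0 : (0 : ℝ) < n := Nat.cast_pos.2 hn
  have hs : 0 < √(n : ℝ) := Real.sqrt_pos.2 hn0
  have hsq : (n : ℝ) = √(n : ℝ) * √(n : ℝ) := (Real.mul_self_sqrt hn0.le).symm
  generalize √(n : ℝ) = q at *
  rw [hsq]
  field_simp
  ring

/-- Asymptotic normality of a sum evaluated at a consistent approximate root `V` (in local
coordinates) of the score equations. -/
theorem IsSample.tendstoInDistribution_plugin [DecidableEq ι] [IsProbabilityMeasure P]
    (hξ : IsSample P Q ξ) {ψ : ι → 𝓞 → ℝ} {B : ι → ι → 𝓞 → ℝ} {H M : 𝓞 → ℝ} {h : ι → 𝓞 → ℝ}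
    {V : ι → ℕ → Ω → ℝ} {S : ℕ → Ω → ℝ} {J : Matrix ι ι ℝ}
    (hψ : ∀ k, MemLp (ψ k) 2 Q) (hH : MemLp H 2 Q) (hB : ∀ j k, Integrable (B j k) Q)
    (hh : ∀ j, Integrable (h j) Q) (hM : Integrable M Q)
    (hJ : ∀ j k, J j k = -∫ o, B j k o ∂Q) (hdet : IsUnit J.det)
    (hS : ∀ n, AEMeasurable (S n) P)
    (hV : ∀ᵐ ω ∂P, ∀ j, Tendsto (fun n => V j n ω) atTop (𝓝 0))
    (hscore : ∀ᵐ ω ∂P, ∀ᶠ n in atTop, ∀ k,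
      |∑ i ∈ Finset.range n, ψ k (ξ i ω) + ∑ j, V j n ω * ∑ i ∈ Finset.range n, B j k (ξ i ω)|
        ≤ (∑ j, |V j n ω|) ^ 2 * ∑ i ∈ Finset.range n, M (ξ i ω))
    (hexp : ∀ᵐ ω ∂P, ∀ᶠ n in atTop,
      |S n ω - ∑ i ∈ Finset.range n, H (ξ i ω)
        - ∑ j, V j n ω * ∑ i ∈ Finset.range n, h j (ξ i ω)|
        ≤ (∑ j, |V j n ω|) ^ 2 * ∑ i ∈ Finset.range n, M (ξ i ω)) :
    (∀ k, ∫ o, ψ k o ∂Q = 0) ∧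
    TendstoInDistribution (fun (n : ℕ) ω => 1 / √n * S n ω - √n * ∫ o, H o ∂Q) atTop (id : ℝ → ℝ)
      (fun _ => P) (gaussianReal 0
        Var[fun o => H o + ∑ k, (J⁻¹ *ᵥ fun j => ∫ o, h j o ∂Q) k * ψ k o; Q].toNNReal) := by
  set B₀ : Matrix ι ι ℝ := fun j k => ∫ o, B j k o ∂Q with hB₀
  have hJB : J = -B₀ := by ext j k; rw [hJ]; rfl
  set h₀ : ι → ℝ := fun j => ∫ o, h j o ∂Q with hh₀
  set a : ι → ℝ := J⁻¹ *ᵥ h₀ with ha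
  have hQ : IsProbabilityMeasure Q := by
    rw [← hξ.law 0]; exact Measure.isProbabilityMeasure_map (hξ.aemeasurable 0)
  have hψi : ∀ k, Integrable (ψ k) Q := fun k => (hψ k).integrable (by norm_num)
  have hHi : Integrable H Q := hH.integrable (by norm_num)
  have lB : ∀ᵐ ω ∂P, ∀ j k, Tendsto (fun n : ℕ => (∑ i ∈ Finset.range n, B j k (ξ i ω)) / n)
      atTop (𝓝 (B₀ j k)) :=
    ae_all_iff.2 fun j => ae_all_iff.2 fun k => hξ.strong_law (hB j k)
  have lh : ∀ᵐ ω ∂P, ∀ j, Tendsto (fun n : ℕ => (∑ i ∈ Finset.range n, h j (ξ i ω)) / n)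
      atTop (𝓝 (h₀ j)) := ae_all_iff.2 fun j => hξ.strong_law (hh j)
  have lM := hξ.strong_law hM
  have hscore' : ∀ᵐ ω ∂P, ∀ᶠ n : ℕ in atTop, ∀ k,
      |(∑ i ∈ Finset.range n, ψ k (ξ i ω)) / n
        + ∑ j, V j n ω * ((∑ i ∈ Finset.range n, B j k (ξ i ω)) / n)|
        ≤ (∑ j, |V j n ω|) ^ 2 * ((∑ i ∈ Finset.range n, M (ξ i ω)) / n) := by
    filter_upwards [hscore] with ω hω
    filter_upwards [hω] with n hn k
    rw [div_add_sum_mul_div]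
    exact sum_div_sq_le (hn k)
  have hexp' : ∀ᵐ ω ∂P, ∀ᶠ n : ℕ in atTop,
      |(S n ω - ∑ i ∈ Finset.range n, H (ξ i ω)) / n
        - ∑ j, V j n ω * ((∑ i ∈ Finset.range n, h j (ξ i ω)) / n)|
        ≤ (∑ j, |V j n ω|) ^ 2 * ((∑ i ∈ Finset.range n, M (ξ i ω)) / n) := by
    filter_upwards [hexp] with ω hω
    filter_upwards [hω] with n hn
    have := sum_div_sq_le (n := n) hn
    rw [sub_div, Finset.sum_div] at this
    simpa only [mul_div_assoc] using this
  -- The average score converges to E ψₖ by the strong law and to 0 by the score expansion;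
  -- uniqueness of limits on a single path suffices.
  have hmean : ∀ k, ∫ o, ψ k o ∂Q = 0 := fun k => by
    have : ∀ᵐ ω ∂P, (∫ o, ψ k o ∂Q) = 0 := by
      filter_upwards [lB, lM, hV, hscore', hξ.strong_law (hψi k)] with ω h1 h2 h3 h4 h5
      exact tendsto_nhds_unique h5
        (tendsto_score_zero (s := fun k (n : ℕ) => (∑ i ∈ Finset.range n, ψ k (ξ i ω)) / n)
          h3 h1 h2 h4 k)
    exact this.exists.choose_spec
  refine ⟨hmean, ?_⟩
  -- the linear part
  have hW : MemLp (fun o => H o + ∑ k, a k * ψ k o) 2 Q :=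
    hH.add (memLp_finsetSum _ fun k _ => (hψ k).const_mul (a k))
  have hWmean : ∫ o, (H o + ∑ k, a k * ψ k o) ∂Q = ∫ o, H o ∂Q := by
    rw [integral_add hHi (integrable_finsetSum _ fun k _ => (hψi k).const_mul _),
      integral_finsetSum _ fun k _ => (hψi k).const_mul _]
    simp [integral_const_mul, hmean]
  have hclt := hξ.central_limit hW
  rw [hWmean] at hclt
  -- Slutsky: only the difference from the normalized sum of H + Σ aₖψₖ remains to be shown
  -- negligible.
  refine tendstoInDistribution_of_tendstoInMeasure_sub _ _ hclt ?_ fun n =>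
    ((hS n).const_mul _).sub_const _
  -- the remainder
  have hlin : ∀ᵐ ω ∂P, (fun n : ℕ => (S n ω - ∑ i ∈ Finset.range n, H (ξ i ω)) / n
      - ∑ k, a k * ((∑ i ∈ Finset.range n, ψ k (ξ i ω)) / n)) =o[atTop]
        fun n : ℕ => ∑ k, |(∑ i ∈ Finset.range n, ψ k (ξ i ω)) / n| := by
    filter_upwards [lB, lh, lM, hV, hscore', hexp'] with ω h1 h2 h3 h4 h5 h6
    have := isLittleO_linearization (hJB ▸ hdet) h4 h1 h3 h2 h5 h6
    rw [← hJB] at this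
    exact this
  have hWm : ∀ n : ℕ, AEMeasurable (fun ω => (√(n : ℝ))⁻¹ *
      (∑ i ∈ Finset.range n, (H (ξ i ω) + ∑ k, a k * ψ k (ξ i ω)) - n * ∫ o, H o ∂Q)) P :=
    hclt.forall_aemeasurable
  -- The normalizer is Σ √n|ψ̄ₖ|. Since each ψₖ is centred, its second moment is bounded in n; the
  -- factor `Fintype.card ι` comes from Cauchy–Schwarz.
  refine tendstoInMeasure_zero_of_le_mul
    (U := fun n ω => ∑ k, √(n : ℝ) * |(∑ i ∈ Finset.range n, ψ k (ξ i ω)) / (n : ℝ)|)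
    (C := Fintype.card ι * ∑ k, Var[ψ k; Q])
    (fun n => (((hS n).const_mul _).sub_const _).sub (hWm n))
    (fun n => memLp_finsetSum _ fun k _ => hξ.memLp_mean (hψ k) n)
    (fun n => integral_sq_sum_le (fun k => hξ.memLp_mean (hψ k) n)
      fun k => hξ.integral_sq_mean_le (hψ k) (hmean k) n) ?_
  intro e he
  filter_upwards [hlin] with ω hω
  filter_upwards [hω.bound he, eventually_gt_atTop 0] with n hn hn0
  have hs : 0 < √(n : ℝ) := Real.sqrt_pos.2 (Nat.cast_pos.2 hn0)
  rw [Real.norm_eq_abs, Real.norm_eq_abs, abs_of_nonneg (a := ∑ k, _)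
    (Finset.sum_nonneg fun k _ => abs_nonneg _)] at hn
  have hsum : ∑ k, a k * ((∑ i ∈ Finset.range n, ψ k (ξ i ω)) / (n : ℝ))
      = (∑ i ∈ Finset.range n, ∑ k, a k * ψ k (ξ i ω)) / n := by
    rw [Finset.sum_comm, Finset.sum_div]
    simp only [Finset.mul_sum, Finset.sum_div, mul_div_assoc]
  simp only [Pi.sub_apply]
  rw [Finset.sum_add_distrib, sqrt_normalization hn0, ← hsum, abs_mul, abs_of_pos hs,
    ← Finset.mul_sum, mul_left_comm]
  gcongr

end MEstimation

/-! ### Wald consistency of maximizers -/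

section Consistency

variable {Ω 𝓞 E : Type*} [MeasurableSpace Ω] [MeasurableSpace 𝓞] [PseudoMetricSpace E]
  {P : Measure Ω} {Q : Measure 𝓞} {ξ : ℕ → Ω → 𝓞} {ℓ : 𝓞 → E → ℝ} {Θ : Set E}

/-- Allows uncountable local suprema to be replaced by countable, hence measurable, ones. -/
theorem le_of_dense_of_continuousOn {f : E → ℝ} {D S : Set E} {b : ℝ} (hf : ContinuousOn f S)
    (hDS : D ⊆ S) (hS : S ⊆ closure D) (hb : ∀ θ ∈ D, f θ ≤ b) : ∀ θ ∈ S, f θ ≤ b := by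
  intro θ hθ
  have h1 : (𝓝[D] θ).NeBot := mem_closure_iff_nhdsWithin_neBot.1 (hS hθ)
  exact le_of_tendsto ((hf θ hθ).mono_left (nhdsWithin_mono θ hDS))
    (eventually_nhdsWithin_of_forall hb)

/-- A limit in the sense of Fatou: if integrable `h n ≤ b` converge to `f` and `c ≤ ∫ h n`, then
`f` is integrable with `c ≤ ∫ f`. -/
theorem integrable_and_le_integral_of_tendsto {h : ℕ → 𝓞 → ℝ} {b f : 𝓞 → ℝ} {c : ℝ}
    (hb : Integrable b Q) (hh : ∀ n, Integrable (h n) Q) (hle : ∀ᵐ o ∂Q, ∀ n, h n o ≤ b o)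
    (hf : AEMeasurable f Q) (hlim : ∀ᵐ o ∂Q, Tendsto (fun n => h n o) atTop (𝓝 (f o)))
    (hc : ∀ n, c ≤ ∫ o, h n o ∂Q) : Integrable f Q ∧ c ≤ ∫ o, f o ∂Q := by
  have hfb : ∀ᵐ o ∂Q, f o ≤ b o := by
    filter_upwards [hle, hlim] with o h1 h2
    exact le_of_tendsto h2 (Eventually.of_forall h1)
  -- Nonnegativity is what allows the final `ENNReal.ofReal` inequality to be read back in ℝ.
  have hA : 0 ≤ ∫ o, b o ∂Q - c := by
    have : ∫ o, h 0 o ∂Q ≤ ∫ o, b o ∂Q :=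
      integral_mono_ae (hh 0) hb (hle.mono fun o ho => ho 0)
    linarith [hc 0]
  have key : ∫⁻ o, ENNReal.ofReal (b o - f o) ∂Q ≤ ENNReal.ofReal (∫ o, b o ∂Q - c) := by
    calc ∫⁻ o, ENNReal.ofReal (b o - f o) ∂Q
        = ∫⁻ o, liminf (fun n => ENNReal.ofReal (b o - h n o)) atTop ∂Q := by
          refine lintegral_congr_ae ?_
          filter_upwards [hlim] with o ho
          exact ((ENNReal.continuous_ofReal.tendsto _).comp (ho.const_sub (b o))).liminf_eq.symm
      _ ≤ liminf (fun n => ∫⁻ o, ENNReal.ofReal (b o - h n o) ∂Q) atTop :=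
          lintegral_liminf_le' fun n => (hb.sub (hh n)).1.aemeasurable.ennreal_ofReal
      _ ≤ ENNReal.ofReal (∫ o, b o ∂Q - c) := by
          refine liminf_le_of_le (by isBoundedDefault) fun a ha => ?_
          obtain ⟨n, hn⟩ := ha.exists
          refine hn.trans ?_
          have h0 : 0 ≤ᵐ[Q] fun o => b o - h n o := by
            filter_upwards [hle] with o ho
            exact sub_nonneg.2 (ho n)
          rw [← ofReal_integral_eq_lintegral_ofReal (f := fun o => b o - h n o) (hb.sub (hh n)) h0]
          refine ENNReal.ofReal_le_ofReal ?_
          rw [integral_sub hb (hh n)]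
          linarith [hc n]
  have h0 : 0 ≤ᵐ[Q] fun o => b o - f o := hfb.mono fun o ho => sub_nonneg.2 ho
  have hbf : Integrable (fun o => b o - f o) Q := by
    refine ⟨(hb.1.aemeasurable.sub hf).aestronglyMeasurable, ?_⟩
    rw [hasFiniteIntegral_iff_ofReal h0]
    exact key.trans_lt ENNReal.ofReal_lt_top
  have hfi : Integrable f Q := by
    refine (hb.sub hbf).congr (ae_of_all _ fun o => ?_)
    simp
  refine ⟨hfi, ?_⟩
  rw [← ofReal_integral_eq_lintegral_ofReal hbf h0, ENNReal.ofReal_le_ofReal_iff hA,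
    integral_sub hb hfi] at key
  linarith

/-- Near a parameter whose criterion is less than `c`, the criterion function has an integrable
majorant with integral less than `c`. -/
theorem exists_local_majorant [SecondCountableTopology E] {θ : E} {c : ℝ} (hθ : θ ∈ Θ)
    (hmeas : ∀ θ ∈ Θ, AEMeasurable (fun o => ℓ o θ) Q)
    (hcont : ∀ᵐ o ∂Q, ContinuousOn (ℓ o) Θ) [IsFiniteMeasure Q]
    {ρ : ℝ} (hρ : 0 < ρ) {B : 𝓞 → ℝ} (hB : Integrable B Q)
    (hbound : ∀ᵐ o ∂Q, ∀ θ' ∈ Θ ∩ Metric.ball θ ρ, ℓ o θ' ≤ B o)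
    (hlt : Integrable (fun o => ℓ o θ) Q → ∫ o, ℓ o θ ∂Q < c) :
    ∃ r > 0, ∃ g : 𝓞 → ℝ, Integrable g Q ∧ ∫ o, g o ∂Q < c ∧
      ∀ᵐ o ∂Q, ∀ θ' ∈ Θ ∩ Metric.ball θ r, ℓ o θ' ≤ g o := by
  set r : ℕ → ℝ := fun n => ρ / (n + 1) with hr
  have hr0 : ∀ n, 0 < r n := fun n => by positivity
  have hrρ : ∀ n, r n ≤ ρ := fun n => div_le_self hρ.le (by linarith [n.cast_nonneg (α := ℝ)])
  have hrlim : Tendsto r atTop (𝓝 0) := by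
    have := tendsto_one_div_add_atTop_nhds_zero_nat (𝕜 := ℝ)
    simpa [hr, div_eq_mul_inv] using this.const_mul ρ
  choose D hDS hDc hSD using fun n =>
    (TopologicalSpace.IsSeparable.of_separableSpace
      (Θ ∩ Metric.ball θ (r n))).exists_countable_dense_subset
  have hθS : ∀ n, θ ∈ Θ ∩ Metric.ball θ (r n) := fun n => ⟨hθ, Metric.mem_ball_self (hr0 n)⟩
  have hDne : ∀ n, Nonempty (D n) := fun n => by
    have : (closure (D n)).Nonempty := ⟨θ, hSD n (hθS n)⟩
    exact (closure_nonempty_iff.1 this).to_subtype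
  let G : ℕ → 𝓞 → ℝ := fun n o => ⨆ q : D n, ℓ o q
  -- ℓ at θ may have mean −∞, so the local suprema need not be integrable. The floor −n restores
  -- integrability and disappears in the limit.
  let h : ℕ → 𝓞 → ℝ := fun n o => max (G n o) (-n)
  have hGub : ∀ᵐ o ∂Q, ∀ n, (∀ θ' ∈ Θ ∩ Metric.ball θ (r n), ℓ o θ' ≤ G n o) ∧ G n o ≤ B o := by
    filter_upwards [hcont, hbound] with o h1 h2 n
    have hDB : ∀ q : D n, ℓ o q ≤ B o := fun q =>
      h2 q ⟨(hDS n q.2).1, Metric.ball_subset_ball (hrρ n) (hDS n q.2).2⟩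
    have hbdd : BddAbove (Set.range fun q : D n => ℓ o q) := ⟨B o, by
      rintro _ ⟨q, rfl⟩; exact hDB q⟩
    refine ⟨le_of_dense_of_continuousOn (h1.mono Set.inter_subset_left) (hDS n) (hSD n)
      fun q hq => le_ciSup hbdd ⟨q, hq⟩, ciSup_le hDB⟩
  have hle : ∀ᵐ o ∂Q, ∀ n, h n o ≤ |B o| := by
    filter_upwards [hGub] with o ho n
    refine max_le ((ho n).2.trans (le_abs_self _)) ?_
    linarith [abs_nonneg (B o), n.cast_nonneg (α := ℝ)]
  have hGm : ∀ n, AEMeasurable (G n) Q := fun n => by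
    have := (hDc n).to_subtype
    exact AEMeasurable.iSup fun q => hmeas q (hDS n q.2).1
  have hint : ∀ n, Integrable (h n) Q := fun n => by
    refine Integrable.mono' (hB.abs.add (integrable_const (n : ℝ)))
      ((hGm n).max aemeasurable_const).aestronglyMeasurable ?_
    filter_upwards [hle] with o ho
    have h1 := ho n
    have h2 : (-n : ℝ) ≤ h n o := le_max_right _ _
    have h3 := abs_nonneg (B o)
    have h4 := n.cast_nonneg (α := ℝ)
    rw [Real.norm_eq_abs, Pi.add_apply, abs_le]
    constructor <;> linarith
  have hlim : ∀ᵐ o ∂Q, Tendsto (fun n => h n o) atTop (𝓝 (ℓ o θ)) := by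
    filter_upwards [hcont, hGub] with o h1 h2
    rw [Metric.tendsto_atTop]
    intro ε hε
    have h3 := (h1 θ hθ).eventually (Metric.ball_mem_nhds _ (half_pos hε))
    obtain ⟨δ, hδ, hδ'⟩ := Metric.mem_nhdsWithin_iff.1 h3
    have ev : ∀ᶠ n : ℕ in atTop, r n < δ ∧ -ℓ o θ ≤ n :=
      (hrlim.eventually_lt_const hδ).and (tendsto_natCast_atTop_atTop.eventually_ge_atTop _)
    obtain ⟨N, hN⟩ := eventually_atTop.1 ev
    refine ⟨N, fun n hn => ?_⟩
    obtain ⟨hn1, hn2⟩ := hN n hn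
    have h4 : ℓ o θ ≤ G n o := (h2 n).1 θ (hθS n)
    have h5 : G n o ≤ ℓ o θ + ε / 2 := ciSup_le fun q => by
      have hq := hDS n q.2
      have : (q : E) ∈ Metric.ball θ δ ∩ Θ := ⟨Metric.ball_subset_ball hn1.le hq.2, hq.1⟩
      have := hδ' this
      simp only [Set.mem_ofPred_eq, Real.dist_eq] at this
      linarith [(abs_lt.1 this).2]
    have h6 : h n o = G n o := max_eq_left (by linarith)
    rw [h6, Real.dist_eq, abs_lt]
    constructor <;> linarith
  by_contra hcon
  push Not at hcon
  -- If no radius worked, every truncated supremum would have mean at least c, and Fatou would pass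
  -- both integrability and this bound to ℓ at θ.
  have hcn : ∀ n, c ≤ ∫ o, h n o ∂Q := fun n => by
    by_contra hn
    obtain ho := hcon (r n) (hr0 n) (h n) (hint n) (not_le.1 hn)
    refine ho ?_
    filter_upwards [hGub] with o ho' ⟨θ', hθ', hlt'⟩
    exact absurd (((ho' n).1 θ' hθ').trans (le_max_left _ _)) (not_le.2 hlt')
  obtain ⟨h1, h2⟩ := integrable_and_le_integral_of_tendsto hB.abs hint hle (hmeas θ hθ) hlim hcn
  exact absurd (hlt h1) (not_lt.2 h2)

/-- Consistency of maximizers of the empirical criterion over a compact parameter space. -/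
theorem IsSample.tendsto_of_isMaxOn (hξ : IsSample P Q ξ) (hΘ : IsCompact Θ) {θs : E}
    (hθs : θs ∈ Θ) (hint : Integrable (fun o => ℓ o θs) Q)
    (hsep : ∀ θ ∈ Θ, θ ≠ θs → ∃ r > 0, ∃ g : 𝓞 → ℝ, Integrable g Q ∧
      ∫ o, g o ∂Q < ∫ o, ℓ o θs ∂Q ∧ ∀ᵐ o ∂Q, ∀ θ' ∈ Θ ∩ Metric.ball θ r, ℓ o θ' ≤ g o)
    {θhat : ℕ → Ω → E}
    (hhat : ∀ n, ∀ᵐ ω ∂P, θhat n ω ∈ Θ ∧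
      IsMaxOn (fun θ => ∑ i ∈ Finset.range n, ℓ (ξ i ω) θ) Θ (θhat n ω)) :
    ∀ᵐ ω ∂P, Tendsto (fun n => θhat n ω) atTop (𝓝 θs) := by
  have key : ∀ m : ℕ, ∀ᵐ ω ∂P, ∀ᶠ n in atTop, θhat n ω ∈ Metric.ball θs (1 / (m + 1)) := by
    intro m
    -- On each of the finitely many balls covering K the empirical criterion is eventually below its
    -- value at θs, so no maximizer can lie in K.
    set K : Set E := Θ \ Metric.ball θs (1 / (m + 1)) with hK
    have hKc : IsCompact K := hΘ.diff Metric.isOpen_ball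
    have hKne : ∀ θ ∈ K, θ ∈ Θ ∧ θ ≠ θs := fun θ hθ =>
      ⟨hθ.1, fun h => hθ.2 (h ▸ Metric.mem_ball_self (by positivity))⟩
    choose! r hr g hg hgc hgb using fun θ (hθ : θ ∈ K) => hsep θ (hKne θ hθ).1 (hKne θ hθ).2
    obtain ⟨t, htK, hcov⟩ := hKc.elim_nhds_subcover (fun θ => Metric.ball θ (r θ))
      fun θ hθ => Metric.ball_mem_nhds θ (hr θ hθ)
    have h1 : ∀ᵐ ω ∂P, ∀ θ ∈ t, Tendsto
        (fun n : ℕ => (∑ i ∈ Finset.range n, g θ (ξ i ω)) / n) atTop (𝓝 (∫ o, g θ o ∂Q)) :=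
      (Finset.eventually_all t).2 fun θ hθ => hξ.strong_law (hg θ (htK θ hθ))
    have h2 : ∀ᵐ ω ∂P, ∀ θ ∈ t, ∀ i, ∀ θ' ∈ Θ ∩ Metric.ball θ (r θ),
        ℓ (ξ i ω) θ' ≤ g θ (ξ i ω) :=
      (Finset.eventually_all t).2 fun θ hθ => hξ.ae (hgb θ (htK θ hθ))
    filter_upwards [h1, h2, hξ.strong_law hint, ae_all_iff.2 hhat] with ω e1 e2 e3 e4
    have e5 : ∀ᶠ n : ℕ in atTop, ∀ θ ∈ t, (∑ i ∈ Finset.range n, g θ (ξ i ω)) / n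
        < (∑ i ∈ Finset.range n, ℓ (ξ i ω) θs) / n :=
      (Finset.eventually_all t).2 fun θ hθ => (e1 θ hθ).eventually_lt e3 (hgc θ (htK θ hθ))
    filter_upwards [e5, eventually_gt_atTop 0] with n hn hn0
    by_contra hcon
    obtain ⟨h4, h5⟩ := e4 n
    obtain ⟨θ, hθt, hθ⟩ := Set.mem_iUnion₂.1 (hcov ⟨h4, hcon⟩)
    have h6 := hn θ hθt
    have hn0' : (0 : ℝ) < n := Nat.cast_pos.2 hn0
    rw [div_lt_div_iff_of_pos_right hn0'] at h6
    have h7 : ∑ i ∈ Finset.range n, ℓ (ξ i ω) (θhat n ω) ≤ ∑ i ∈ Finset.range n, g θ (ξ i ω) :=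
      Finset.sum_le_sum fun i _ => e2 θ hθt i _ ⟨h4, hθ⟩
    have h8 := h5 hθs
    simp only [Set.mem_ofPred_eq] at h8
    linarith
  filter_upwards [ae_all_iff.2 key] with ω hω
  rw [Metric.tendsto_nhds]
  intro ε hε
  obtain ⟨m, hm⟩ := exists_nat_one_div_lt hε
  exact (hω m).mono fun n hn => (Metric.mem_ball.1 hn).trans hm

end Consistency

/-! ### Measurability and algebra of the working model -/

namespace Model

variable {d m p : ℕ} (𝓜 : Model d m p)

theorem measurable_uncurry_f (ξ : Fin p → ℝ) :
    Measurable fun z : (Fin d → ℝ) × ℝ => 𝓜.f z.2 z.1 ξ :=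
  (𝓜.measurable_f ξ).comp measurable_swap

theorem measurable_f_left (x : Fin d → ℝ) (ξ : Fin p → ℝ) : Measurable fun y => 𝓜.f y x ξ :=
  (𝓜.measurable_f ξ).comp (measurable_id.prodMk measurable_const)

theorem measurable_c (γ : ℝ) (ξ : Fin p → ℝ) : Measurable fun x => 𝓜.c x γ ξ := by
  have := 𝓜.sigmaFinite
  have h : StronglyMeasurable
      (Function.uncurry fun (x : Fin d → ℝ) (y : ℝ) => Real.exp (γ * y) * 𝓜.f y x ξ) :=
    Measurable.stronglyMeasurable <|
      (Real.measurable_exp.comp (measurable_snd.const_mul γ)).mul (𝓜.measurable_uncurry_f ξ)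
  exact Real.measurable_log.comp h.integral_prod_right.measurable

theorem measurable_rfun_apply (j : Fin m) : Measurable fun x => 𝓜.rfun x j :=
  (measurable_pi_apply j).comp 𝓜.measurable_rfun

theorem measurable_marginal (θ : Param m p) : Measurable fun x => 𝓜.marginal x θ := by
  have h1 := 𝓜.measurable_c θ.γ θ.ξ
  have h2 := 𝓜.measurable_rfun_apply
  unfold marginal
  fun_prop

theorem marginal_pos (x : Fin d → ℝ) (θ : Param m p) : 0 < 𝓜.marginal x θ := by
  unfold marginal; positivity

theorem marginal_lt_one (x : Fin d → ℝ) (θ : Param m p) : 𝓜.marginal x θ < 1 := by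
  unfold marginal
  rw [div_lt_one (by positivity)]
  linarith [Real.exp_pos (θ.α + ∑ j, θ.β j * 𝓜.rfun x j + 𝓜.c x θ.γ θ.ξ)]

theorem measurable_logLik (θ : Param m p) : Measurable fun o : Obs d => 𝓜.logLik o θ := by
  have h1 : Measurable fun o : Obs d => 𝓜.marginal o.2.1 θ :=
    (𝓜.measurable_marginal θ).comp (measurable_fst.comp measurable_snd)
  have h2 : Measurable fun o : Obs d => 𝓜.f o.1 o.2.1 θ.ξ :=
    (𝓜.measurable_f θ.ξ).comp (measurable_fst.prodMk (measurable_fst.comp measurable_snd))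
  unfold logLik
  fun_prop

theorem measurable_H (θ : Param m p) : Measurable fun o : Obs d => 𝓜.H o θ := by
  have h1 : Measurable fun o : Obs d => 𝓜.marginal o.2.1 θ :=
    (𝓜.measurable_marginal θ).comp (measurable_fst.comp measurable_snd)
  unfold H
  fun_prop

theorem lik_one (y : ℝ) (x : Fin d → ℝ) (θ : Param m p) :
    𝓜.lik (y, x, 1) θ = 𝓜.f y x θ.ξ * 𝓜.marginal x θ := by
  simp [lik]

theorem lik_zero (y : ℝ) (x : Fin d → ℝ) (θ : Param m p) :
    𝓜.lik (y, x, 0) θ = 1 - 𝓜.marginal x θ := by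
  simp [lik]

theorem logLik_zero (y : ℝ) (x : Fin d → ℝ) (θ : Param m p) :
    𝓜.logLik (y, x, 0) θ = Real.log (1 - 𝓜.marginal x θ) := by
  simp [logLik]

/-- Positivity is essential: if f vanishes at an observed outcome, the convention log 0 = 0 breaks
the identity. -/
theorem exp_logLik {o : Obs d} {θ : Param m p} (ho : o.2.2 = 0 ∨ o.2.2 = 1)
    (hpos : 0 < 𝓜.lik o θ) : Real.exp (𝓜.logLik o θ) = 𝓜.lik o θ := by
  obtain ⟨y, x, r⟩ := o
  have h1 := 𝓜.marginal_pos x θ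
  have h2 := 𝓜.marginal_lt_one x θ
  rcases ho with rfl | rfl
  · rw [logLik_zero, lik_zero, Real.exp_log (by linarith)]
  · rw [lik_one] at hpos ⊢
    have hf : 0 < 𝓜.f y x θ.ξ := pos_of_mul_pos_left hpos h1.le
    simp only [logLik, one_mul, sub_self, zero_mul, add_zero]
    rw [Real.exp_add, Real.exp_log hf, Real.exp_log h1]

theorem measurable_lik (θ : Param m p) : Measurable fun o : Obs d => 𝓜.lik o θ := by
  have h1 : Measurable fun o : Obs d => 𝓜.marginal o.2.1 θ :=
    (𝓜.measurable_marginal θ).comp (measurable_fst.comp measurable_snd)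
  have h2 : Measurable fun o : Obs d => 𝓜.f o.1 o.2.1 θ.ξ :=
    (𝓜.measurable_f θ.ξ).comp (measurable_fst.prodMk (measurable_fst.comp measurable_snd))
  unfold lik
  fun_prop

theorem propensity_pos (x : Fin d → ℝ) (y : ℝ) (α : ℝ) (β : Fin m → ℝ) (γ : ℝ) :
    0 < 𝓜.propensity x y α β γ := by
  unfold propensity; positivity

theorem measurable_propensity (α : ℝ) (β : Fin m → ℝ) (γ : ℝ) :
    Measurable fun z : (Fin d → ℝ) × ℝ => 𝓜.propensity z.1 z.2 α β γ := by
  have h : ∀ j, Measurable fun z : (Fin d → ℝ) × ℝ => 𝓜.rfun z.1 j :=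
    fun j => (𝓜.measurable_rfun_apply j).comp measurable_fst
  unfold propensity
  fun_prop

/-- Integrating the inverse propensity over the outcome distribution of the respondents gives the
inverse marginal propensity. -/
theorem lintegral_inv_propensity (x : Fin d → ℝ) (θ : Param m p)
    (h1 : ∫⁻ y, ENNReal.ofReal (𝓜.f y x θ.ξ) ∂𝓜.ν = 1)
    (h2 : ∫⁻ y, ENNReal.ofReal (Real.exp (θ.γ * y) * 𝓜.f y x θ.ξ) ∂𝓜.ν ≠ ⊤) :
    ∫⁻ y, ENNReal.ofReal (𝓜.f y x θ.ξ) * (ENNReal.ofReal (𝓜.propensity x y θ.α θ.β θ.γ))⁻¹ ∂𝓜.ν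
      = (ENNReal.ofReal (𝓜.marginal x θ))⁻¹ := by
  set a := θ.α + ∑ j, θ.β j * 𝓜.rfun x j with ha
  have hfm := 𝓜.measurable_f_left x θ.ξ
  have hgm : Measurable fun y => Real.exp (θ.γ * y) * 𝓜.f y x θ.ξ := by fun_prop
  have hg0 : ∀ y, 0 ≤ Real.exp (θ.γ * y) * 𝓜.f y x θ.ξ := fun y =>
    mul_nonneg (Real.exp_pos _).le (𝓜.f_nonneg _ _ _)
  have hgi : Integrable (fun y => Real.exp (θ.γ * y) * 𝓜.f y x θ.ξ) 𝓜.ν := by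
    refine ⟨hgm.aestronglyMeasurable, ?_⟩
    rw [hasFiniteIntegral_iff_ofReal (ae_of_all _ hg0)]
    exact lt_top_iff_ne_top.2 h2
  -- A zero integral would force f = 0 almost everywhere, against total mass one. Positivity makes
  -- the exponential cancel the logarithm in c.
  have hpos : 0 < ∫ y, Real.exp (θ.γ * y) * 𝓜.f y x θ.ξ ∂𝓜.ν := by
    refine lt_of_le_of_ne (integral_nonneg hg0) fun h => ?_
    have h3 := (integral_eq_zero_iff_of_nonneg hg0 hgi).1 h.symm
    have h4 : ∫⁻ y, ENNReal.ofReal (𝓜.f y x θ.ξ) ∂𝓜.ν = 0 := by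
      rw [lintegral_eq_zero_iff hfm.ennreal_ofReal]
      filter_upwards [h3] with y hy
      have : 𝓜.f y x θ.ξ = 0 := by simpa [(Real.exp_pos _).ne'] using hy
      simp [this]
    exact one_ne_zero (h1.symm.trans h4)
  have hprop : ∀ y, (ENNReal.ofReal (𝓜.propensity x y θ.α θ.β θ.γ))⁻¹
      = 1 + ENNReal.ofReal (Real.exp a) * ENNReal.ofReal (Real.exp (θ.γ * y)) := fun y => by
    rw [← ENNReal.ofReal_inv_of_pos (𝓜.propensity_pos _ _ _ _ _),
      ← ENNReal.ofReal_mul (Real.exp_pos _).le, ← Real.exp_add, propensity, one_div, inv_inv,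
      ENNReal.ofReal_add zero_le_one (Real.exp_pos _).le, ENNReal.ofReal_one]
  have hmarg : (ENNReal.ofReal (𝓜.marginal x θ))⁻¹ = 1 + ENNReal.ofReal (Real.exp a) *
      ENNReal.ofReal (∫ y, Real.exp (θ.γ * y) * 𝓜.f y x θ.ξ ∂𝓜.ν) := by
    rw [← ENNReal.ofReal_inv_of_pos (𝓜.marginal_pos _ _),
      ← ENNReal.ofReal_mul (Real.exp_pos _).le, marginal, one_div, inv_inv, Real.exp_add, c,
      Real.exp_log hpos, ENNReal.ofReal_add zero_le_one (by positivity), ENNReal.ofReal_one]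
  rw [hmarg, ofReal_integral_eq_lintegral_ofReal hgi (ae_of_all _ hg0), ← h1,
    ← lintegral_const_mul _ hgm.ennreal_ofReal, ← lintegral_add_left hfm.ennreal_ofReal]
  refine lintegral_congr fun y => ?_
  rw [hprop, ENNReal.ofReal_mul (Real.exp_pos _).le]
  ring

end Model

/-! ### Decomposition of the observation law by response status -/

section Law

variable {d m p : ℕ} {Ω : Type*} [MeasurableSpace Ω] {P : Measure Ω}
  {Y : Ω → ℝ} {X : Ω → Fin d → ℝ} {R : Ω → ℝ}

/-- The law of `(X, Y)` on the event `R = 1`. -/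
noncomputable def respLaw (P : Measure Ω) (Y : Ω → ℝ) (X : Ω → Fin d → ℝ) (R : Ω → ℝ) :
    Measure ((Fin d → ℝ) × ℝ) :=
  (P.restrict {ω | R ω = 1}).map fun ω => (X ω, Y ω)

/-- The law of `X` on the event `R = r`. -/
noncomputable def covLaw (P : Measure Ω) (X : Ω → Fin d → ℝ) (R : Ω → ℝ) (r : ℝ) : Measure (Fin d → ℝ) :=
  (P.restrict {ω | R ω = r}).map X

instance [IsFiniteMeasure P] (r : ℝ) : IsFiniteMeasure (covLaw P X R r) := by
  unfold covLaw; infer_instance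

instance [IsFiniteMeasure P] : IsFiniteMeasure (respLaw P Y X R) := by
  unfold respLaw; infer_instance

theorem restrict_add_restrict (hR : Measurable R) (hR01 : ∀ ω, R ω = 0 ∨ R ω = 1) :
    P.restrict {ω | R ω = 1} + P.restrict {ω | R ω = 0} = P := by
  have h1 : MeasurableSet {ω | R ω = 1} := hR (measurableSet_singleton 1)
  have h2 : {ω | R ω = 0} = {ω | R ω = 1}ᶜ := by
    ext ω
    rcases hR01 ω with h | h <;> simp [h]
  rw [h2]
  exact Measure.restrict_add_restrict_compl h1

theorem covLaw_add_covLaw (hX : Measurable X) (hR : Measurable R)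
    (hR01 : ∀ ω, R ω = 0 ∨ R ω = 1) : covLaw P X R 1 + covLaw P X R 0 = P.map X := by
  unfold covLaw
  rw [← Measure.map_add _ _ hX, restrict_add_restrict hR hR01]

/-- On R = 0 the recorded outcome RY is 0, so only the covariate law survives there. -/
theorem obsLaw_eq_add (hY : Measurable Y) (hX : Measurable X) (hR : Measurable R)
    (hR01 : ∀ ω, R ω = 0 ∨ R ω = 1) :
    obsLaw P Y X R = (respLaw P Y X R).map (fun z => (z.2, z.1, 1))
      + (covLaw P X R 0).map (fun x => (0, x, 0)) := by
  have h1 : MeasurableSet {ω | R ω = 1} := hR (measurableSet_singleton 1)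
  have h0 : MeasurableSet {ω | R ω = 0} := hR (measurableSet_singleton 0)
  have hm : Measurable fun ω => ((R ω * Y ω, X ω, R ω) : Obs d) := by fun_prop
  unfold obsLaw respLaw covLaw
  rw [Measure.map_map (by fun_prop) (by fun_prop), Measure.map_map (by fun_prop) (by fun_prop)]
  conv_lhs => rw [← restrict_add_restrict (P := P) hR hR01]
  rw [Measure.map_add _ _ hm]
  congr 1
  · refine Measure.map_congr ?_
    filter_upwards [ae_restrict_mem h1] with ω hω
    have : R ω = 1 := hω
    simp [this]
  · refine Measure.map_congr ?_
    filter_upwards [ae_restrict_mem h0] with ω hω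
    have : R ω = 0 := hω
    simp [this]

theorem map_covariate_obsLaw (hY : Measurable Y) (hX : Measurable X) (hR : Measurable R) :
    (obsLaw P Y X R).map (fun o => o.2.1) = P.map X := by
  unfold obsLaw
  rw [Measure.map_map (by fun_prop) (by fun_prop)]
  rfl

theorem ae_obsLaw_mem_zero_one (hY : Measurable Y) (hX : Measurable X) (hR : Measurable R)
    (hR01 : ∀ ω, R ω = 0 ∨ R ω = 1) : ∀ᵐ o ∂(obsLaw P Y X R), o.2.2 = 0 ∨ o.2.2 = 1 := by
  unfold obsLaw
  rw [ae_map_iff (by fun_prop)]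
  · exact ae_of_all _ hR01
  · have h : Measurable fun o : Obs d => o.2.2 := by fun_prop
    exact (h (measurableSet_singleton 0)).union (h (measurableSet_singleton 1))

variable {𝓜 : Model d m p} {Θ : Set (Param m p)} {θ θ₀ : Param m p}

/-- Fixing θ makes the good set of covariates measurable, so the property can be transferred from
observations to the law of X. -/
theorem WellDefined.ae_covariate [SFinite 𝓜.ν] (hdef : WellDefined 𝓜 Θ (obsLaw P Y X R))
    (hY : Measurable Y) (hX : Measurable X) (hR : Measurable R) (hθ : θ ∈ Θ) :
    ∀ᵐ x ∂(P.map X), ∫⁻ y, ENNReal.ofReal (𝓜.f y x θ.ξ) ∂𝓜.ν = 1 ∧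
      ∫⁻ y, ENNReal.ofReal (Real.exp (θ.γ * y) * 𝓜.f y x θ.ξ) ∂𝓜.ν ≠ ⊤ := by
  have hf := 𝓜.measurable_uncurry_f θ.ξ
  have m1 : Measurable fun x => ∫⁻ y, ENNReal.ofReal (𝓜.f y x θ.ξ) ∂𝓜.ν :=
    hf.ennreal_ofReal.lintegral_prod_right'
  have m2 : Measurable fun x =>
      ∫⁻ y, ENNReal.ofReal (Real.exp (θ.γ * y) * 𝓜.f y x θ.ξ) ∂𝓜.ν := by
    have : Measurable fun z : (Fin d → ℝ) × ℝ =>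
      ENNReal.ofReal (Real.exp (θ.γ * z.2) * 𝓜.f z.2 z.1 θ.ξ) := by fun_prop
    exact this.lintegral_prod_right'
  have hm : MeasurableSet {x | ∫⁻ y, ENNReal.ofReal (𝓜.f y x θ.ξ) ∂𝓜.ν = 1 ∧
      ∫⁻ y, ENNReal.ofReal (Real.exp (θ.γ * y) * 𝓜.f y x θ.ξ) ∂𝓜.ν ≠ ⊤} :=
    (m1 (measurableSet_singleton 1)).inter (m2 (measurableSet_singleton ⊤)).compl
  rw [← map_covariate_obsLaw hY hX hR, ae_map_iff (by fun_prop) hm]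
  filter_upwards [hdef.density, hdef.mgf] with o h1 h2
  refine ⟨h1 θ hθ, ?_⟩
  have h3 := (h2 θ hθ).2
  rw [hasFiniteIntegral_iff_ofReal (ae_of_all _ fun y =>
    mul_nonneg (Real.exp_pos _).le (𝓜.f_nonneg _ _ _))] at h3
  exact h3.ne

theorem covLaw_le (hX : Measurable X) (r : ℝ) : covLaw P X R r ≤ P.map X :=
  Measure.map_mono Measure.restrict_le_self hX

theorem respLaw_eq_withDensity (hA2 : 𝓜.IsOutcomeDensity P Y X R θ.ξ) :
    respLaw P Y X R = ((covLaw P X R 1).prod 𝓜.ν).withDensity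
      (fun z => ENNReal.ofReal (𝓜.f z.2 z.1 θ.ξ)) := hA2

/-- Under the null model the law of `(X, Y)` has density `π₀` on the event `R = 1`. -/
theorem Model.NullAt.respLaw_eq [IsProbabilityMeasure P] (h : 𝓜.NullAt P Y X R θ)
    (hY : Measurable Y) (hX : Measurable X) (hR : Measurable R)
    (hR01 : ∀ ω, R ω = 0 ∨ R ω = 1) :
    respLaw P Y X R = (P.map fun ω => (X ω, Y ω)).withDensity
      (fun z => ENNReal.ofReal (𝓜.propensity z.1 z.2 θ.α θ.β θ.γ)) := by
  have h1 : MeasurableSet {ω | R ω = 1} := hR (measurableSet_singleton 1)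
  have hXY : Measurable fun ω => (X ω, Y ω) := by fun_prop
  have hπ := 𝓜.measurable_propensity θ.α θ.β θ.γ
  have hRi : Integrable R P := by
    refine Integrable.of_bound hR.aestronglyMeasurable 1 (ae_of_all _ fun ω => ?_)
    rcases hR01 ω with h | h <;> simp [h]
  ext B hB
  have hBm : MeasurableSet ((fun ω => (X ω, Y ω)) ⁻¹' B) := hXY hB
  have hint : Integrable (fun ω => 𝓜.propensity (X ω) (Y ω) θ.α θ.β θ.γ) P :=
    integrable_condExp.congr h.propensity_eq
  rw [withDensity_apply _ hB, setLIntegral_map hB hπ.ennreal_ofReal hXY,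
    ← ofReal_integral_eq_lintegral_ofReal hint.restrict
      (ae_of_all _ fun ω => (𝓜.propensity_pos _ _ _ _ _).le),
    ← setIntegral_congr_ae hBm (h.propensity_eq.mono fun ω hω _ => hω),
    setIntegral_condExp hXY.comap_le hRi ⟨B, hB, rfl⟩, respLaw,
    Measure.map_apply hXY hB, Measure.restrict_apply hBm]
  have : ∀ ω, R ω = ({ω | R ω = 1}).indicator (fun _ => (1 : ℝ)) ω := fun ω => by
    rcases hR01 ω with h | h <;> simp [h]
  rw [integral_congr_ae (ae_of_all _ this), setIntegral_indicator h1, setIntegral_const]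
  simp

theorem setLIntegral_prod_univ_withDensity {α β : Type*} [MeasurableSpace α] [MeasurableSpace β]
    {μ : Measure α} [SFinite μ] {ν : Measure β} [SFinite ν] {f g : α × β → ℝ≥0∞}
    (hf : Measurable f) (hg : Measurable g) {A : Set α} (hA : MeasurableSet A) :
    ∫⁻ z in A ×ˢ Set.univ, g z ∂(μ.prod ν).withDensity f
      = ∫⁻ x in A, ∫⁻ y, f (x, y) * g (x, y) ∂ν ∂μ := by
  rw [setLIntegral_withDensity_eq_setLIntegral_mul _ hf hg (hA.prod MeasurableSet.univ),
    ← Measure.prod_restrict, Measure.restrict_univ, lintegral_prod _ (hf.mul hg).aemeasurable]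
  rfl

/-- Under the null model the law of `X` has density `1 / π` with respect to its restriction to the
event `R = 1`. -/
theorem Model.NullAt.map_eq_withDensity [IsProbabilityMeasure P] (h : 𝓜.NullAt P Y X R θ)
    (hdef : WellDefined 𝓜 Θ (obsLaw P Y X R)) (hθ : θ ∈ Θ)
    (hY : Measurable Y) (hX : Measurable X) (hR : Measurable R)
    (hR01 : ∀ ω, R ω = 0 ∨ R ω = 1) :
    P.map X = (covLaw P X R 1).withDensity (fun x => (ENNReal.ofReal (𝓜.marginal x θ))⁻¹) := by
  have := 𝓜.sigmaFinite
  have hXY : Measurable fun ω => (X ω, Y ω) := by fun_prop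
  have hπ := (𝓜.measurable_propensity θ.α θ.β θ.γ).ennreal_ofReal
  -- Since π₀ is positive and finite, the respondents' density can be inverted to recover the full
  -- law of (X, Y).
  have hinv : P.map (fun ω => (X ω, Y ω)) = (respLaw P Y X R).withDensity
      fun z => (ENNReal.ofReal (𝓜.propensity z.1 z.2 θ.α θ.β θ.γ))⁻¹ := by
    rw [h.respLaw_eq hY hX hR hR01]
    exact (withDensity_inv_same hπ
      (ae_of_all _ fun z => (ENNReal.ofReal_pos.2 (𝓜.propensity_pos _ _ _ _ _)).ne')
      (ae_of_all _ fun z => ENNReal.ofReal_ne_top)).symm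
  have hwd := ae_mono (covLaw_le (P := P) (R := R) hX 1) (hdef.ae_covariate hY hX hR hθ)
  ext A hA
  have hAm : MeasurableSet (A ×ˢ (Set.univ : Set ℝ)) := hA.prod MeasurableSet.univ
  have e1 : P.map X A = P.map (fun ω => (X ω, Y ω)) (A ×ˢ Set.univ) := by
    rw [Measure.map_apply hX hA, Measure.map_apply hXY hAm]
    congr 1
    ext ω
    simp
  have hf := (𝓜.measurable_uncurry_f θ.ξ).ennreal_ofReal
  have hπi : Measurable fun z : (Fin d → ℝ) × ℝ =>
    (ENNReal.ofReal (𝓜.propensity z.1 z.2 θ.α θ.β θ.γ))⁻¹ := hπ.inv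
  rw [e1, hinv, withDensity_apply _ hAm, respLaw_eq_withDensity h.outcome,
    setLIntegral_prod_univ_withDensity hf hπi hA, withDensity_apply _ hA]
  refine lintegral_congr_ae (ae_restrict_of_ae ?_)
  filter_upwards [hwd] with x hx
  exact 𝓜.lintegral_inv_propensity x θ hx.1 hx.2

/-- The law of X is the sum of its parts on R = 1 and R = 0, and 1/π = 1 + (1 − π)/π; cancelling the
finite part on R = 1 leaves the claim. -/
theorem Model.NullAt.covLaw_zero_eq [IsProbabilityMeasure P] (h : 𝓜.NullAt P Y X R θ)
    (hdef : WellDefined 𝓜 Θ (obsLaw P Y X R)) (hθ : θ ∈ Θ)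
    (hY : Measurable Y) (hX : Measurable X) (hR : Measurable R)
    (hR01 : ∀ ω, R ω = 0 ∨ R ω = 1) :
    covLaw P X R 0 = (covLaw P X R 1).withDensity
      (fun x => ENNReal.ofReal ((1 - 𝓜.marginal x θ) / 𝓜.marginal x θ)) := by
  have hπ := 𝓜.measurable_marginal θ
  have e1 : (fun x => (ENNReal.ofReal (𝓜.marginal x θ))⁻¹) = (1 : (Fin d → ℝ) → ℝ≥0∞) + fun x =>
      ENNReal.ofReal ((1 - 𝓜.marginal x θ) / 𝓜.marginal x θ) := by
    funext x
    have h1 := 𝓜.marginal_pos x θ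
    have h2 := 𝓜.marginal_lt_one x θ
    rw [Pi.add_apply, Pi.one_apply, ← ENNReal.ofReal_inv_of_pos h1, ← ENNReal.ofReal_one,
      ← ENNReal.ofReal_add zero_le_one (div_nonneg (by linarith) h1.le)]
    congr 1
    field_simp
    ring
  have e2 := h.map_eq_withDensity hdef hθ hY hX hR hR01
  rw [e1, withDensity_add_left measurable_one, withDensity_one,
    ← covLaw_add_covLaw hX hR hR01] at e2
  ext A hA
  have e3 := congrArg (fun μ : Measure (Fin d → ℝ) => μ A) e2
  simp only [Measure.add_apply] at e3
  exact (ENNReal.add_right_inj (measure_ne_top _ _)).1 e3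

end Law

/-! ### Expected log-likelihood with values in `EReal` -/

section ExpectedLogLikelihood

variable {d m p : ℕ} {𝓜 : Model d m p} {Θ : Set (Param m p)} {θ θ₀ θs : Param m p}
  {Q : Measure (Obs d)}

theorem Model.expLogLik_eq_integral (h : Integrable (fun o => 𝓜.logLik o θ) Q) :
    𝓜.expLogLik Q θ = ((∫ o, 𝓜.logLik o θ ∂Q : ℝ) : EReal) := by
  have hneg : ∫⁻ o, ENNReal.ofReal (-𝓜.logLik o θ) ∂Q < ⊤ := h.neg.lintegral_lt_top
  rw [integral_eq_lintegral_pos_part_sub_lintegral_neg_part h, Model.expLogLik, EReal.coe_sub,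
    EReal.coe_ennreal_toReal h.lintegral_lt_top.ne, EReal.coe_ennreal_toReal hneg.ne]

/-- In `EReal` subtracting ⊤ always gives ⊥, so a value above ⊥ already forces the negative part to
be integrable. -/
theorem Model.integrable_logLik_of_bot_lt
    (hpos : ∫⁻ o, ENNReal.ofReal (𝓜.logLik o θ) ∂Q ≠ ⊤) (h : ⊥ < 𝓜.expLogLik Q θ) :
    Integrable (fun o => 𝓜.logLik o θ) Q := by
  have hneg : ∫⁻ o, ENNReal.ofReal (-𝓜.logLik o θ) ∂Q ≠ ⊤ := by
    intro hn
    rw [Model.expLogLik, hn] at h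
    simp at h
  refine ⟨(𝓜.measurable_logLik θ).aestronglyMeasurable, ?_⟩
  calc ∫⁻ o, ‖𝓜.logLik o θ‖ₑ ∂Q
      ≤ ∫⁻ o, (ENNReal.ofReal (𝓜.logLik o θ) + ENNReal.ofReal (-𝓜.logLik o θ)) ∂Q := by
        refine lintegral_mono fun o => ?_
        rw [Real.enorm_eq_ofReal_abs]
        rcases abs_choice (𝓜.logLik o θ) with h | h <;> rw [h]
        · exact le_self_add
        · exact le_add_self
    _ = _ := lintegral_add_left (𝓜.measurable_logLik θ).ennreal_ofReal _
    _ < ⊤ := ENNReal.add_lt_top.2 ⟨hpos.lt_top, hneg.lt_top⟩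

/-- The local supremum of the log-likelihood has an integrable majorant. -/
theorem Model.exists_integrable_local_bound
    (hsm : ∀ᵐ o ∂Q, (∀ θ ∈ Θ, 0 < 𝓜.lik o θ) ∧ ContinuousOn (𝓜.logLik o) Θ)
    (h01 : ∀ᵐ o ∂Q, o.2.2 = 0 ∨ o.2.2 = 1) {ρ : ℝ}
    (hsup : ∫⁻ o, (ENNReal.log (1 + 𝓜.supLik Θ o θ ρ)).toENNReal ∂Q < ⊤) :
    ∃ B : Obs d → ℝ, Integrable B Q ∧
      ∀ᵐ o ∂Q, ∀ θ' ∈ Θ ∩ Metric.ball θ ρ, 𝓜.logLik o θ' ≤ B o := by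
  obtain ⟨D, hDS, hDc, hSD⟩ := (TopologicalSpace.IsSeparable.of_separableSpace
      (Θ ∩ Metric.ball θ ρ)).exists_countable_dense_subset
  have := hDc.to_subtype
  -- The supremum over all of Θ ∩ ball may fail to be measurable. Over a countable dense set it is
  -- measurable, no larger, and by continuity still controls every θ'.
  let F : Obs d → ℝ≥0∞ := fun o =>
    (ENNReal.log (1 + ⨆ q : D, ENNReal.ofReal (𝓜.lik o q))).toENNReal
  have hFm : Measurable F := by
    refine (Measurable.ennreal_log (measurable_const.add (Measurable.iSup fun q => ?_))).ereal_toENNReal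
    exact (𝓜.measurable_lik q).ennreal_ofReal
  have hF : ∫⁻ o, F o ∂Q < ⊤ := by
    refine (lintegral_mono fun o => ?_).trans_lt hsup
    refine EReal.toENNReal_le_toENNReal (ENNReal.log_monotone ?_)
    gcongr
    refine iSup_le fun q => ?_
    exact le_iSup₂ (f := fun θ' (_ : θ' ∈ Θ ∩ Metric.ball θ ρ) => ENNReal.ofReal (𝓜.lik o θ'))
      (q : Param m p) (hDS q.2)
  refine ⟨fun o => (F o).toReal, integrable_toReal_of_lintegral_ne_top hFm.aemeasurable hF.ne, ?_⟩
  filter_upwards [hsm, h01, ae_lt_top hFm hF.ne] with o h1 h2 h3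
  refine le_of_dense_of_continuousOn (h1.2.mono Set.inter_subset_left) hDS hSD fun q hq => ?_
  have hlik := 𝓜.exp_logLik h2 (h1.1 q (hDS hq).1)
  have e1 : ENNReal.ofReal (𝓜.logLik o q) ≤ F o := by
    rw [← EReal.real_coe_toENNReal]
    refine EReal.toENNReal_le_toENNReal ?_
    rw [← Real.log_exp (𝓜.logLik o q), ← ENNReal.log_ofReal_of_pos (Real.exp_pos _), hlik]
    refine ENNReal.log_monotone (le_add_left ?_)
    exact le_iSup (fun q : D => ENNReal.ofReal (𝓜.lik o q)) ⟨q, hq⟩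
  calc 𝓜.logLik o q ≤ (ENNReal.ofReal (𝓜.logLik o q)).toReal := by
        rw [ENNReal.toReal_ofReal']; exact le_max_left _ _
    _ ≤ (F o).toReal := ENNReal.toReal_mono h3.ne e1

end ExpectedLogLikelihood

/-! ### Information inequality under the null model -/

section Information

variable {d m p : ℕ} {Ω : Type*} [MeasurableSpace Ω] {P : Measure Ω}
  {Y : Ω → ℝ} {X : Ω → Fin d → ℝ} {R : Ω → ℝ}
  {𝓜 : Model d m p} {Θ : Set (Param m p)} {θ θ₀ θs : Param m p} {ξ₀ : Fin p → ℝ}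

/-- Equality can fail only where f(y|x;ξ) at θ₀ vanishes; there the left side is 0 whatever the
right side is. -/
theorem mul_lik_ratio_one_le (y : ℝ) (x : Fin d → ℝ) :
    ENNReal.ofReal (𝓜.f y x θ₀.ξ) * ENNReal.ofReal (𝓜.lik (y, x, 1) θ / 𝓜.lik (y, x, 1) θ₀)
      ≤ ENNReal.ofReal (𝓜.f y x θ.ξ) * ENNReal.ofReal (𝓜.marginal x θ / 𝓜.marginal x θ₀) := by
  have h1 := 𝓜.marginal_pos x θ
  have h2 := 𝓜.marginal_pos x θ₀
  rw [← ENNReal.ofReal_mul (𝓜.f_nonneg _ _ _), ← ENNReal.ofReal_mul (𝓜.f_nonneg _ _ _)]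
  refine ENNReal.ofReal_le_ofReal ?_
  rw [𝓜.lik_one, 𝓜.lik_one]
  have h4 := 𝓜.f_nonneg y x θ.ξ
  rcases (𝓜.f_nonneg y x θ₀.ξ).eq_or_lt with h3 | h3
  · rw [← h3, zero_mul]; positivity
  · refine le_of_eq ?_
    field_simp

theorem mul_lik_ratio_zero (x : Fin d → ℝ) :
    ENNReal.ofReal ((1 - 𝓜.marginal x θ₀) / 𝓜.marginal x θ₀)
        * ENNReal.ofReal (𝓜.lik (0, x, 0) θ / 𝓜.lik (0, x, 0) θ₀)
      = ENNReal.ofReal ((1 - 𝓜.marginal x θ) / 𝓜.marginal x θ₀) := by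
  have h1 := 𝓜.marginal_pos x θ₀
  have h2 := 𝓜.marginal_lt_one x θ₀
  have h3 : 1 - 𝓜.marginal x θ₀ ≠ 0 := by linarith
  rw [← ENNReal.ofReal_mul (div_nonneg (by linarith) h1.le), 𝓜.lik_zero, 𝓜.lik_zero]
  congr 1
  field_simp

/-- The likelihood ratio against the true null parameter has mean at most one. -/
theorem Model.NullAt.lintegral_lik_ratio_le [IsProbabilityMeasure P] (h : 𝓜.NullAt P Y X R θ₀)
    (hdef : WellDefined 𝓜 Θ (obsLaw P Y X R)) (hθ₀ : θ₀ ∈ Θ) (hθ : θ ∈ Θ)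
    (hY : Measurable Y) (hX : Measurable X) (hR : Measurable R)
    (hR01 : ∀ ω, R ω = 0 ∨ R ω = 1) :
    ∫⁻ o, ENNReal.ofReal (𝓜.lik o θ / 𝓜.lik o θ₀) ∂(obsLaw P Y X R) ≤ 1 := by
  have := 𝓜.sigmaFinite
  set F : Obs d → ℝ≥0∞ := fun o => ENNReal.ofReal (𝓜.lik o θ / 𝓜.lik o θ₀) with hF
  have hFm : Measurable F := ((𝓜.measurable_lik θ).div (𝓜.measurable_lik θ₀)).ennreal_ofReal
  have hF1 : Measurable fun z : (Fin d → ℝ) × ℝ => F (z.2, z.1, 1) := hFm.comp (by fun_prop)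
  have hF0 : Measurable fun x : Fin d → ℝ => F (0, x, 0) := hFm.comp (by fun_prop)
  have hfm := (𝓜.measurable_uncurry_f θ₀.ξ).ennreal_ofReal
  have hwd := ae_mono (covLaw_le (P := P) (R := R) hX 1) (hdef.ae_covariate hY hX hR hθ)
  have hr0 : Measurable fun x => ENNReal.ofReal ((1 - 𝓜.marginal x θ₀) / 𝓜.marginal x θ₀) := by
    have := 𝓜.measurable_marginal θ₀
    fun_prop
  have hr1 : Measurable fun x => ENNReal.ofReal ((1 - 𝓜.marginal x θ) / 𝓜.marginal x θ₀) := by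
    have := 𝓜.measurable_marginal θ₀
    have := 𝓜.measurable_marginal θ
    fun_prop
  have e1 : ∫⁻ z, F (z.2, z.1, 1) ∂(respLaw P Y X R)
      ≤ ∫⁻ x, ENNReal.ofReal (𝓜.marginal x θ / 𝓜.marginal x θ₀) ∂(covLaw P X R 1) := by
    rw [respLaw_eq_withDensity h.outcome, ← setLIntegral_univ, ← Set.univ_prod_univ,
      setLIntegral_prod_univ_withDensity hfm hF1 MeasurableSet.univ, setLIntegral_univ]
    refine lintegral_mono_ae ?_
    filter_upwards [hwd] with x hx
    refine (lintegral_mono fun y => mul_lik_ratio_one_le y x).trans (le_of_eq ?_)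
    rw [lintegral_mul_const _ (𝓜.measurable_f_left x θ.ξ).ennreal_ofReal, hx.1, one_mul]
  have e0 : ∫⁻ x, F (0, x, 0) ∂(covLaw P X R 0)
      = ∫⁻ x, ENNReal.ofReal ((1 - 𝓜.marginal x θ) / 𝓜.marginal x θ₀) ∂(covLaw P X R 1) := by
    rw [h.covLaw_zero_eq hdef hθ₀ hY hX hR hR01, lintegral_withDensity_eq_lintegral_mul _ hr0 hF0]
    exact lintegral_congr fun x => mul_lik_ratio_zero x
  rw [obsLaw_eq_add hY hX hR hR01, lintegral_add_measure, lintegral_map hFm (by fun_prop),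
    lintegral_map hFm (by fun_prop), e0]
  refine (add_le_add_left e1 _).trans ?_
  rw [← lintegral_add_right _ hr1]
  -- The contributions of R = 1 and R = 0 add up to 1/π at θ₀, the density of the law of X relative
  -- to the respondents' covariate law, so the total is a probability.
  have e2 : ∀ x, ENNReal.ofReal (𝓜.marginal x θ / 𝓜.marginal x θ₀)
      + ENNReal.ofReal ((1 - 𝓜.marginal x θ) / 𝓜.marginal x θ₀)
      = (ENNReal.ofReal (𝓜.marginal x θ₀))⁻¹ := fun x => by
    have h1 := 𝓜.marginal_pos x θ₀
    have h2 := 𝓜.marginal_lt_one x θ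
    rw [← ENNReal.ofReal_add (div_nonneg (𝓜.marginal_pos x θ).le h1.le)
      (div_nonneg (by linarith) h1.le), ← ENNReal.ofReal_inv_of_pos h1]
    congr 1
    field_simp
    ring
  simp_rw [e2]
  have e3 := congrArg (fun μ : Measure (Fin d → ℝ) => μ Set.univ)
    (h.map_eq_withDensity hdef hθ₀ hY hX hR hR01)
  simp only [withDensity_apply _ MeasurableSet.univ, setLIntegral_univ] at e3
  rw [← e3, Measure.map_apply hX MeasurableSet.univ]
  exact prob_le_one

/-- Parameters with the same likelihood as the true null parameter give the same conditional
law. -/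
theorem Model.NullAt.sameLaw_of_lik_eq [IsProbabilityMeasure P] (h : 𝓜.NullAt P Y X R θ₀)
    (hdef : WellDefined 𝓜 Θ (obsLaw P Y X R)) (hθ₀ : θ₀ ∈ Θ) (hθ : θ ∈ Θ)
    (hY : Measurable Y) (hX : Measurable X) (hR : Measurable R)
    (hR01 : ∀ ω, R ω = 0 ∨ R ω = 1)
    (heq : ∀ᵐ o ∂(obsLaw P Y X R), 𝓜.lik o θ = 𝓜.lik o θ₀) :
    𝓜.SameLaw (obsLaw P Y X R) θ θ₀ := by
  have := 𝓜.sigmaFinite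
  have hfm := (𝓜.measurable_uncurry_f θ₀.ξ).ennreal_ofReal
  have hr0 : Measurable fun x => ENNReal.ofReal ((1 - 𝓜.marginal x θ₀) / 𝓜.marginal x θ₀) := by
    have := 𝓜.measurable_marginal θ₀
    fun_prop
  rw [obsLaw_eq_add hY hX hR hR01, ae_add_measure_iff] at heq
  have h1 : ∀ᵐ z ∂(respLaw P Y X R), 𝓜.lik (z.2, z.1, 1) θ = 𝓜.lik (z.2, z.1, 1) θ₀ :=
    ae_of_ae_map (by fun_prop) heq.1
  have h0 : ∀ᵐ x ∂(covLaw P X R 0), 𝓜.lik (0, x, 0) θ = 𝓜.lik (0, x, 0) θ₀ :=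
    ae_of_ae_map (by fun_prop) heq.2
  rw [h.covLaw_zero_eq hdef hθ₀ hY hX hR hR01, ae_withDensity_iff hr0] at h0
  rw [respLaw_eq_withDensity h.outcome, ae_withDensity_iff hfm] at h1
  have h1' := Measure.ae_ae_of_ae_prod h1
  have hle := covLaw_le (P := P) (R := R) hX 1
  have key : ∀ᵐ x ∂(covLaw P X R 1), 𝓜.marginal x θ = 𝓜.marginal x θ₀ ∧
      ∀ᵐ y ∂𝓜.ν, 𝓜.f y x θ.ξ = 𝓜.f y x θ₀.ξ := by
    filter_upwards [h0, h1', ae_mono hle (hdef.ae_covariate hY hX hR hθ),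
      ae_mono hle (hdef.ae_covariate hY hX hR hθ₀)] with x a0 a1 a2 a3
    have hm : 𝓜.marginal x θ = 𝓜.marginal x θ₀ := by
      have := a0 (ENNReal.ofReal_pos.2 (div_pos (sub_pos.2 (𝓜.marginal_lt_one x θ₀))
        (𝓜.marginal_pos x θ₀))).ne'
      rw [𝓜.lik_zero, 𝓜.lik_zero] at this
      linarith
    refine ⟨hm, ?_⟩
    -- The equality of likelihoods is known only where the density at θ₀ is positive, which gives a
    -- one-sided comparison. Two densities of mass one, one dominating the other, coincide.
    have hle : (fun y => ENNReal.ofReal (𝓜.f y x θ₀.ξ)) ≤ᵐ[𝓜.ν]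
        fun y => ENNReal.ofReal (𝓜.f y x θ.ξ) := by
      filter_upwards [a1] with y hy
      by_cases hz : ENNReal.ofReal (𝓜.f y x θ₀.ξ) = 0
      · rw [hz]; exact zero_le
      · have := hy hz
        rw [𝓜.lik_one, 𝓜.lik_one, hm] at this
        rw [mul_right_cancel₀ (𝓜.marginal_pos x θ₀).ne' this]
    have := ae_eq_of_ae_le_of_lintegral_le hle (by rw [a3.1]; exact ENNReal.one_ne_top)
      (𝓜.measurable_f_left x θ.ξ).ennreal_ofReal.aemeasurable (by rw [a2.1, a3.1])
    filter_upwards [this] with y hy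
    exact ((ENNReal.ofReal_eq_ofReal_iff (𝓜.f_nonneg _ _ _) (𝓜.f_nonneg _ _ _)).1 hy).symm
  -- Respondents reveal almost every x, since the law of X has density 1/π relative to theirs.
  have hac : P.map X ≪ covLaw P X R 1 := by
    rw [h.map_eq_withDensity hdef hθ₀ hY hX hR hR01]
    exact withDensity_absolutelyContinuous _ _
  have := hac.ae_le key
  rw [← map_covariate_obsLaw hY hX hR] at this
  exact ae_of_ae_map (by fun_prop) this

/-- The information inequality at the true null parameter, with its equality case. -/
theorem Model.NullAt.sameLaw_of_integral_le [IsProbabilityMeasure P] (h : 𝓜.NullAt P Y X R θ₀)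
    (hdef : WellDefined 𝓜 Θ (obsLaw P Y X R)) (hθ₀ : θ₀ ∈ Θ) (hθ : θ ∈ Θ)
    (hY : Measurable Y) (hX : Measurable X) (hR : Measurable R)
    (hR01 : ∀ ω, R ω = 0 ∨ R ω = 1)
    (hpos : ∀ᵐ o ∂(obsLaw P Y X R), ∀ θ ∈ Θ, 0 < 𝓜.lik o θ)
    (hi : Integrable (fun o => 𝓜.logLik o θ) (obsLaw P Y X R))
    (hi₀ : Integrable (fun o => 𝓜.logLik o θ₀) (obsLaw P Y X R))
    (hle : ∫ o, 𝓜.logLik o θ₀ ∂(obsLaw P Y X R) ≤ ∫ o, 𝓜.logLik o θ ∂(obsLaw P Y X R)) :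
    𝓜.SameLaw (obsLaw P Y X R) θ θ₀ := by
  have hQ : IsProbabilityMeasure (obsLaw P Y X R) :=
    Measure.isProbabilityMeasure_map (by fun_prop)
  refine h.sameLaw_of_lik_eq hdef hθ₀ hθ hY hX hR hR01 ?_
  have h01 := ae_obsLaw_mem_zero_one (P := P) hY hX hR hR01
  have hLR := h.lintegral_lik_ratio_le hdef hθ₀ hθ hY hX hR hR01
  generalize obsLaw P Y X R = Q at *
  set u : Obs d → ℝ := fun o => 𝓜.lik o θ / 𝓜.lik o θ₀ with hu
  have hum : Measurable u := (𝓜.measurable_lik θ).div (𝓜.measurable_lik θ₀)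
  have hu0 : 0 ≤ᵐ[Q] u := by
    filter_upwards [hpos] with o ho
    exact (div_pos (ho θ hθ) (ho θ₀ hθ₀)).le
  have hui : Integrable u Q :=
    ⟨hum.aestronglyMeasurable, by
      rw [hasFiniteIntegral_iff_ofReal hu0]; exact hLR.trans_lt ENNReal.one_lt_top⟩
  have hu1 : ∫ o, u o ∂Q ≤ 1 := by
    rw [← ofReal_integral_eq_lintegral_ofReal hui hu0, ← ENNReal.ofReal_one,
      ENNReal.ofReal_le_ofReal_iff zero_le_one] at hLR
    exact hLR
  have hexp : ∀ᵐ o ∂Q, u o = Real.exp (𝓜.logLik o θ - 𝓜.logLik o θ₀) := by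
    filter_upwards [hpos, h01] with o h1 h2
    rw [Real.exp_sub, 𝓜.exp_logLik h2 (h1 θ hθ), 𝓜.exp_logLik h2 (h1 θ₀ hθ₀)]
  have hd : Integrable (fun o => 𝓜.logLik o θ - 𝓜.logLik o θ₀) Q := hi.sub hi₀
  have hu1i : Integrable (fun o => u o - 1) Q := hui.sub (integrable_const 1)
  have hg0 : 0 ≤ᵐ[Q] fun o => u o - 1 - (𝓜.logLik o θ - 𝓜.logLik o θ₀) := by
    filter_upwards [hexp] with o ho
    rw [Pi.zero_apply, ho]
    linarith [Real.add_one_le_exp (𝓜.logLik o θ - 𝓜.logLik o θ₀)]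
  -- Writing u = eᵗ, the function u − 1 − t is nonnegative with mean at most 0, so it vanishes
  -- almost everywhere; strict convexity then gives t = 0.
  have hgi : ∫ o, (u o - 1 - (𝓜.logLik o θ - 𝓜.logLik o θ₀)) ∂Q = 0 := by
    refine le_antisymm ?_ (integral_nonneg_of_ae hg0)
    rw [integral_sub hu1i hd, integral_sub hui (integrable_const 1), integral_sub hi hi₀]
    simp only [integral_const, probReal_univ, smul_eq_mul, mul_one]
    linarith
  have hz := (integral_eq_zero_iff_of_nonneg_ae hg0 (hu1i.sub hd)).1 hgi
  filter_upwards [hz, hexp, hpos] with o h1 h2 h3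
  have h4 : 𝓜.logLik o θ - 𝓜.logLik o θ₀ = 0 := by
    by_contra hne
    have := Real.add_one_lt_exp hne
    simp only [Pi.zero_apply] at h1
    linarith
  rw [h4, Real.exp_zero, hu, div_eq_one_iff_eq (h3 θ₀ hθ₀).ne'] at h2
  exact h2

/-- Under the null model `Pr(R = 1 | X)` is the marginal propensity. -/
theorem Model.NullAt.condExp_eq [IsProbabilityMeasure P] (h : 𝓜.NullAt P Y X R θ₀)
    (hdef : WellDefined 𝓜 Θ (obsLaw P Y X R)) (hθ₀ : θ₀ ∈ Θ)
    (hY : Measurable Y) (hX : Measurable X) (hR : Measurable R)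
    (hR01 : ∀ ω, R ω = 0 ∨ R ω = 1) :
    (fun ω => 𝓜.marginal (X ω) θ₀) =ᵐ[P] P[R | MeasurableSpace.comap X inferInstance] := by
  have hπ := 𝓜.measurable_marginal θ₀
  have hπX : Measurable fun ω => 𝓜.marginal (X ω) θ₀ := hπ.comp hX
  have h1 : MeasurableSet {ω | R ω = 1} := hR (measurableSet_singleton 1)
  have hRi : Integrable R P := by
    refine Integrable.of_bound hR.aestronglyMeasurable 1 (ae_of_all _ fun ω => ?_)
    rcases hR01 ω with h | h <;> simp [h]
  have hπi : Integrable (fun ω => 𝓜.marginal (X ω) θ₀) P := by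
    refine Integrable.of_bound hπX.aestronglyMeasurable 1 (ae_of_all _ fun ω => ?_)
    rw [Real.norm_eq_abs, abs_of_pos (𝓜.marginal_pos _ _)]
    exact (𝓜.marginal_lt_one _ _).le
  -- Inverting the density 1/π turns the description of the law of X into one of the respondents'
  -- law.
  have hcov : covLaw P X R 1
      = (P.map X).withDensity (fun x => ENNReal.ofReal (𝓜.marginal x θ₀)) := by
    rw [h.map_eq_withDensity hdef hθ₀ hY hX hR hR01]
    have := withDensity_inv_same (μ := covLaw P X R 1)
      (f := fun x => (ENNReal.ofReal (𝓜.marginal x θ₀))⁻¹) hπ.ennreal_ofReal.inv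
      (ae_of_all _ fun x => ENNReal.inv_ne_zero.2 ENNReal.ofReal_ne_top)
      (ae_of_all _ fun x => ENNReal.inv_ne_top.2 (ENNReal.ofReal_pos.2 (𝓜.marginal_pos _ _)).ne')
    simp only [inv_inv] at this
    exact this.symm
  refine ae_eq_condExp_of_forall_setIntegral_eq hX.comap_le hRi (fun _ _ _ => hπi.integrableOn)
    ?_ (StronglyMeasurable.aestronglyMeasurable ?_)
  · rintro _ ⟨A, hA, rfl⟩ -
    have hAm : MeasurableSet (X ⁻¹' A) := hX hA
    have hRind : ∀ ω, R ω = ({ω | R ω = 1}).indicator (fun _ => (1 : ℝ)) ω := fun ω => by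
      rcases hR01 ω with h | h <;> simp [h]
    have e1 := congrArg (fun μ : Measure (Fin d → ℝ) => μ A) hcov
    simp only [withDensity_apply _ hA] at e1
    rw [setLIntegral_map hA hπ.ennreal_ofReal hX,
      ← ofReal_integral_eq_lintegral_ofReal hπi.restrict
        (ae_of_all _ fun ω => (𝓜.marginal_pos _ _).le), covLaw, Measure.map_apply hX hA,
      Measure.restrict_apply hAm] at e1
    rw [integral_congr_ae (ae_of_all _ hRind), setIntegral_indicator h1, setIntegral_const,
      Measure.real, e1, ENNReal.toReal_ofReal (integral_nonneg fun ω => (𝓜.marginal_pos _ _).le)]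
    simp
  · exact (hπ.comp (comap_measurable X)).stronglyMeasurable

/-- Both functions are densities of the same finite measure, so they agree almost everywhere for the
product measure, and therefore at observed outcomes. -/
theorem Model.IsOutcomeDensity.ae_eq [IsFiniteMeasure P] (h : 𝓜.IsOutcomeDensity P Y X R θ₀.ξ)
    (h' : 𝓜.IsOutcomeDensity P Y X R ξ₀) (hY : Measurable Y) (hX : Measurable X)
    (hR : Measurable R) :
    ∀ᵐ ω ∂P, R ω = 1 → 𝓜.f (Y ω) (X ω) ξ₀ = 𝓜.f (Y ω) (X ω) θ₀.ξ := by
  have := 𝓜.sigmaFinite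
  have hm := (𝓜.measurable_uncurry_f ξ₀).ennreal_ofReal
  have hm₀ := (𝓜.measurable_uncurry_f θ₀.ξ).ennreal_ofReal
  have e : respLaw P Y X R = ((covLaw P X R 1).prod 𝓜.ν).withDensity
      (fun z => ENNReal.ofReal (𝓜.f z.2 z.1 ξ₀)) := h'
  have hfin : ∫⁻ z, ENNReal.ofReal (𝓜.f z.2 z.1 ξ₀) ∂((covLaw P X R 1).prod 𝓜.ν) ≠ ⊤ := by
    have := measure_ne_top (respLaw P Y X R) Set.univ
    rwa [e, withDensity_apply _ MeasurableSet.univ, setLIntegral_univ] at this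
  have h1 := (withDensity_eq_iff hm.aemeasurable hm₀.aemeasurable hfin).1
    (e.symm.trans (respLaw_eq_withDensity h))
  have h2 : ∀ᵐ z ∂(respLaw P Y X R), 𝓜.f z.2 z.1 ξ₀ = 𝓜.f z.2 z.1 θ₀.ξ := by
    rw [e]
    refine (withDensity_absolutelyContinuous _ _).ae_le ?_
    filter_upwards [h1] with z hz
    exact (ENNReal.ofReal_eq_ofReal_iff (𝓜.f_nonneg _ _ _) (𝓜.f_nonneg _ _ _)).1 hz
  have h3 := ae_of_ae_map (f := fun ω => (X ω, Y ω)) (by fun_prop) h2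
  exact (ae_restrict_iff' (hR (measurableSet_singleton 1))).1 h3

/-- L(θ₀) is almost surely the true likelihood: Pr(R = 1 | X) is π at θ₀, and the two outcome
densities agree where the outcome is observed. The assumed integrability of log L_t thus transfers.
-/
theorem Model.NullAt.integrable_logLik [IsProbabilityMeasure P] (h : 𝓜.NullAt P Y X R θ₀)
    (hdef : WellDefined 𝓜 Θ (obsLaw P Y X R)) (hθ₀ : θ₀ ∈ Θ)
    (hY : Measurable Y) (hX : Measurable X) (hR : Measurable R)
    (hR01 : ∀ ω, R ω = 0 ∨ R ω = 1) (hA2 : 𝓜.IsOutcomeDensity P Y X R ξ₀)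
    (hpos : ∀ᵐ o ∂(obsLaw P Y X R), ∀ θ ∈ Θ, 0 < 𝓜.lik o θ)
    (hlog : Integrable (fun ω => Real.log (𝓜.trueLik P Y X R ξ₀ ω)) P) :
    Integrable (fun o => 𝓜.logLik o θ₀) (obsLaw P Y X R) := by
  have hm : Measurable fun ω => ((R ω * Y ω, X ω, R ω) : Obs d) := by fun_prop
  rw [obsLaw, integrable_map_measure (𝓜.measurable_logLik θ₀).aestronglyMeasurable hm.aemeasurable]
  refine hlog.congr ?_
  filter_upwards [h.condExp_eq hdef hθ₀ hY hX hR hR01, h.outcome.ae_eq hA2 hY hX hR,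
    ae_of_ae_map hm.aemeasurable hpos] with ω h1 h2 h3
  rw [Function.comp_apply, Model.trueLik, ← h1, ← Real.log_exp (𝓜.logLik _ θ₀),
    𝓜.exp_logLik (hR01 ω) (h3 θ₀ hθ₀)]
  congr 1
  rcases hR01 ω with hr | hr
  · simp [Model.lik, hr]
  · simp [Model.lik, hr, h2 hr]

end Information

/-! ### Finiteness and uniqueness of the maximum -/

section Regularity

variable {d m p : ℕ} {Ω : Type*} [MeasurableSpace Ω] {P : Measure Ω}
  {Y : Ω → ℝ} {X : Ω → Fin d → ℝ} {R : Ω → ℝ}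
  {𝓜 : Model d m p} {Θ : Set (Param m p)} {θs : Param m p} {ξ₀ : Fin p → ℝ}

theorem Regularity.ae_lik_pos (hreg : Regularity 𝓜 Θ P Y X R ξ₀ θs) :
    ∀ᵐ o ∂(obsLaw P Y X R), ∀ θ ∈ Θ, 0 < 𝓜.lik o θ :=
  hreg.smooth.mono fun o ho => (ho o.2.2 (Or.inr rfl)).1

theorem Regularity.ae_continuousOn (hreg : Regularity 𝓜 Θ P Y X R ξ₀ θs) :
    ∀ᵐ o ∂(obsLaw P Y X R), ContinuousOn (𝓜.logLik o) Θ :=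
  hreg.smooth.mono fun o ho => (ho o.2.2 (Or.inr rfl)).2.1

/-- Supplies a competitor: strict inequality against it shows that the maximum of the expected
log-likelihood exceeds ⊥. -/
theorem exists_ne_mem_of_mem_interior {θ : Param m p} (hθ : θ ∈ interior Θ) :
    ∃ θ' ∈ Θ, θ' ≠ θ := by
  have : Nontrivial (Param m p) := by unfold Param; infer_instance
  have h1 : interior Θ ∈ 𝓝[≠] θ := mem_nhdsWithin_of_mem_nhds (isOpen_interior.mem_nhds hθ)
  have h2 : (𝓝[≠] θ).NeBot := Module.punctured_nhds_neBot ℝ (Param m p) θ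
  obtain ⟨θ', h3, h4⟩ := (h2.nonempty_of_mem (inter_mem h1 self_mem_nhdsWithin))
  exact ⟨θ', interior_subset h3, h4⟩

theorem Regularity.exists_integrable_local_bound (hreg : Regularity 𝓜 Θ P Y X R ξ₀ θs)
    (hY : Measurable Y) (hX : Measurable X) (hR : Measurable R)
    (hR01 : ∀ ω, R ω = 0 ∨ R ω = 1) {θ : Param m p} (hθ : θ ∈ Θ) :
    ∃ ρ > 0, ∃ B : Obs d → ℝ, Integrable B (obsLaw P Y X R) ∧
      ∀ᵐ o ∂(obsLaw P Y X R), ∀ θ' ∈ Θ ∩ Metric.ball θ ρ, 𝓜.logLik o θ' ≤ B o := by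
  obtain ⟨ρ, hρ, hρ0⟩ := (hreg.log_supLik.and self_mem_nhdsWithin).exists
  exact ⟨ρ, hρ0, Model.exists_integrable_local_bound (hreg.ae_lik_pos.and hreg.ae_continuousOn)
    (ae_obsLaw_mem_zero_one hY hX hR hR01) (hρ θ hθ)⟩

theorem Regularity.lintegral_logLik_ne_top (hreg : Regularity 𝓜 Θ P Y X R ξ₀ θs)
    (hY : Measurable Y) (hX : Measurable X) (hR : Measurable R)
    (hR01 : ∀ ω, R ω = 0 ∨ R ω = 1) {θ : Param m p} (hθ : θ ∈ Θ) :
    ∫⁻ o, ENNReal.ofReal (𝓜.logLik o θ) ∂(obsLaw P Y X R) ≠ ⊤ := by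
  obtain ⟨ρ, hρ, B, hB, hle⟩ := hreg.exists_integrable_local_bound hY hX hR hR01 hθ
  refine ((lintegral_mono_ae ?_).trans_lt hB.lintegral_lt_top).ne
  filter_upwards [hle] with o ho
  exact ENNReal.ofReal_le_ofReal (ho θ ⟨hθ, Metric.mem_ball_self hρ⟩)

/-- Whether or not the null model holds, the expected log-likelihood is finite at the
(pseudo-)true value, which is its only maximizer. -/
theorem Regularity.integrable_and_unique_max [IsProbabilityMeasure P]
    (hreg : Regularity 𝓜 Θ P Y X R ξ₀ θs)
    (hdef : WellDefined 𝓜 Θ (obsLaw P Y X R)) (hA1 : Assumption1 𝓜 Θ P Y X R)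
    (hA2 : 𝓜.IsOutcomeDensity P Y X R ξ₀) (hθs : IsMaxOn (𝓜.expLogLik (obsLaw P Y X R)) Θ θs)
    (hY : Measurable Y) (hX : Measurable X) (hR : Measurable R)
    (hR01 : ∀ ω, R ω = 0 ∨ R ω = 1) :
    Integrable (fun o => 𝓜.logLik o θs) (obsLaw P Y X R) ∧
      ∀ θ ∈ Θ, θ ≠ θs → Integrable (fun o => 𝓜.logLik o θ) (obsLaw P Y X R) →
        ∫ o, 𝓜.logLik o θ ∂(obsLaw P Y X R) < ∫ o, 𝓜.logLik o θs ∂(obsLaw P Y X R) := by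
  have hmem : θs ∈ Θ := interior_subset hreg.param_interior
  by_cases hnull : ∃ θ₀ ∈ Θ, 𝓜.NullAt P Y X R θ₀
  · obtain ⟨θ₀, hθ₀, h⟩ := hnull
    have hi₀ := h.integrable_logLik hdef hθ₀ hY hX hR hR01 hA2 hreg.ae_lik_pos hreg.log_trueLik
    have key : ∀ θ ∈ Θ, Integrable (fun o => 𝓜.logLik o θ) (obsLaw P Y X R) →
        ∫ o, 𝓜.logLik o θ₀ ∂(obsLaw P Y X R) ≤ ∫ o, 𝓜.logLik o θ ∂(obsLaw P Y X R) → θ = θ₀ :=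
      fun θ hθ hi hle => hA1.identifiable θ₀ hθ₀ h θ hθ
        (h.sameLaw_of_integral_le hdef hθ₀ hθ hY hX hR hR01 hreg.ae_lik_pos hi hi₀ hle)
    -- As E ℓ(θ₀) is finite, maximality makes E ℓ(θs) finite too; `key` then identifies θs with θ₀.
    have hle : 𝓜.expLogLik (obsLaw P Y X R) θ₀ ≤ 𝓜.expLogLik (obsLaw P Y X R) θs := hθs hθ₀
    rw [Model.expLogLik_eq_integral hi₀] at hle
    have his : Integrable (fun o => 𝓜.logLik o θs) (obsLaw P Y X R) :=
      Model.integrable_logLik_of_bot_lt (hreg.lintegral_logLik_ne_top hY hX hR hR01 hmem)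
        ((EReal.bot_lt_coe _).trans_le hle)
    rw [Model.expLogLik_eq_integral his, EReal.coe_le_coe_iff] at hle
    have hs := key θs hmem his hle
    refine ⟨his, fun θ hθ hne hi => ?_⟩
    by_contra hcon
    exact hne ((key θ hθ hi (hle.trans (not_lt.1 hcon))).trans hs.symm)
  · have huniq := hreg.unique_max hnull
    have his : Integrable (fun o => 𝓜.logLik o θs) (obsLaw P Y X R) := by
      obtain ⟨θ', h1, h2⟩ := exists_ne_mem_of_mem_interior hreg.param_interior
      exact Model.integrable_logLik_of_bot_lt (hreg.lintegral_logLik_ne_top hY hX hR hR01 hmem)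
        (bot_le.trans_lt (huniq θ' h1 h2))
    refine ⟨his, fun θ hθ hne hi => ?_⟩
    have := huniq θ hθ hne
    rwa [Model.expLogLik_eq_integral hi, Model.expLogLik_eq_integral his,
      EReal.coe_lt_coe_iff] at this

end Regularity

/-! ### Coordinatewise Taylor expansion -/

section PartialDerivatives

variable {m p : ℕ} {g : Param m p → ℝ} {U : Set (Param m p)} {θ θs : Param m p}

theorem apply_eq_sum_single (L : Param m p →L[ℝ] ℝ) (v : Param m p) :
    L v = ∑ j, v j * L (EuclideanSpace.single j 1) := by
  conv_lhs => rw [← (EuclideanSpace.basisFun (Idx m p) ℝ).sum_repr v]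
  simp [map_sum]

theorem fderiv_apply_eq_sum_pd (v : Param m p) : fderiv ℝ g θ v = ∑ j, v j * pd j g θ :=
  apply_eq_sum_single _ v

theorem abs_apply_le_norm (v : Param m p) (j : Idx m p) : |v j| ≤ ‖v‖ := by
  simpa using PiLp.norm_apply_le v j

theorem norm_le_sum_abs (v : Param m p) : ‖v‖ ≤ ∑ j, |v j| := by
  conv_lhs => rw [← (EuclideanSpace.basisFun (Idx m p) ℝ).sum_repr v]
  refine (norm_sum_le _ _).trans (Finset.sum_le_sum fun j _ => ?_)
  simp [norm_smul]

theorem norm_le_of_abs_apply_single_le {L : Param m p →L[ℝ] ℝ} {M : ℝ}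
    (h : ∀ j, |L (EuclideanSpace.single j 1)| ≤ M) : ‖L‖ ≤ Fintype.card (Idx m p) * M := by
  have hM : 0 ≤ M := (abs_nonneg _).trans (h (Sum.inl ()))
  refine L.opNorm_le_bound (by positivity) fun v => ?_
  rw [apply_eq_sum_single, Real.norm_eq_abs]
  calc |∑ j, v j * L (EuclideanSpace.single j 1)|
      ≤ ∑ j, |v j * L (EuclideanSpace.single j 1)| := Finset.abs_sum_le_sum_abs _ _
    _ ≤ ∑ _j : Idx m p, ‖v‖ * M := by
        refine Finset.sum_le_sum fun j _ => ?_
        rw [abs_mul]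
        exact mul_le_mul (abs_apply_le_norm v j) (h j) (abs_nonneg _) (norm_nonneg _)
    _ = _ := by
        rw [Finset.sum_const, Finset.card_univ, nsmul_eq_mul]
        ring

theorem contDiffOn_pd {n : WithTop ℕ∞} (hU : IsOpen U) (hg : ContDiffOn ℝ (n + 1) g U)
    (i : Idx m p) : ContDiffOn ℝ n (pd i g) U :=
  (hg.fderiv_of_isOpen hU le_rfl).clm_apply contDiffOn_const

theorem pd_comm (hU : IsOpen U) (hg : ContDiffOn ℝ 2 g U) (hθ : θ ∈ U) (i j : Idx m p) :
    pd i (pd j g) θ = pd j (pd i g) θ := by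
  have hat : ContDiffAt ℝ 2 g θ := hg.contDiffAt (hU.mem_nhds hθ)
  have hd : DifferentiableAt ℝ (fderiv ℝ g) θ :=
    (hat.fderiv_right (m := 1) (by norm_num)).differentiableAt (by norm_num)
  have key : ∀ i j : Idx m p, pd i (pd j g) θ
      = fderiv ℝ (fderiv ℝ g) θ (EuclideanSpace.single i 1) (EuclideanSpace.single j 1) := by
    intro i j
    have := fderiv_clm_apply hd (differentiableAt_const (EuclideanSpace.single j (1 : ℝ)))
    unfold pd
    rw [this]
    simp
  rw [key, key]
  exact (hat.isSymmSndFDerivAt (by simp)).eq _ _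

/-- A first-order expansion in coordinates, with a remainder controlled by the second partial
derivatives. -/
theorem abs_sub_sub_sum_pd_le (hU : IsOpen U) (hg : ContDiffOn ℝ 2 g U) {ε M : ℝ}
    (hball : Metric.closedBall θs ε ⊆ U)
    (hM : ∀ θ ∈ Metric.closedBall θs ε, ∀ i j, |pd i (pd j g) θ| ≤ M)
    (hθ : θ ∈ Metric.closedBall θs ε) :
    |g θ - g θs - ∑ j, (θ - θs) j * pd j g θs|
      ≤ (∑ j, |(θ - θs) j|) ^ 2 * ((Fintype.card (Idx m p) : ℝ) ^ 2 * M) := by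
  set N : ℝ := ((Fintype.card (Idx m p) : ℕ) : ℝ) with hN
  -- Working on the ball of radius r instead of ε makes the remainder quadratic in r: one mean value
  -- step bounds the variation of the gradient, a second that of g minus its linear part.
  set r := ‖θ - θs‖ with hr
  have hr0 : 0 ≤ r := norm_nonneg _
  have hrε : r ≤ ε := by rwa [hr, ← dist_eq_norm]
  have hsub : Metric.closedBall θs r ⊆ Metric.closedBall θs ε := Metric.closedBall_subset_closedBall hrε
  have hc : θs ∈ Metric.closedBall θs r := Metric.mem_closedBall_self hr0
  have hM0 : 0 ≤ M := (abs_nonneg _).trans (hM θs (hsub hc) (Sum.inl ()) (Sum.inl ()))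
  have hconv : Convex ℝ (Metric.closedBall θs r) := convex_closedBall θs r
  have hpd : ∀ j, ∀ η ∈ Metric.closedBall θs r, DifferentiableAt ℝ (pd j g) η := fun j η hη =>
    ((contDiffOn_pd (n := 1) hU (by simpa [one_add_one_eq_two] using hg) j).contDiffAt
      (hU.mem_nhds (hball (hsub hη)))).differentiableAt (by norm_num)
  have h1 : ∀ j, ∀ η ∈ Metric.closedBall θs r, |pd j g η - pd j g θs| ≤ N * M * r := by
    intro j η hη
    have := hconv.norm_image_sub_le_of_norm_fderiv_le (𝕜 := ℝ) (hpd j)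
      (fun η' hη' => norm_le_of_abs_apply_single_le fun i => hM η' (hsub hη') i j) hc hη
    rw [Real.norm_eq_abs] at this
    refine this.trans ?_
    gcongr
    rwa [← dist_eq_norm]
  have h2 : ∀ η ∈ Metric.closedBall θs r, ‖fderiv ℝ g η - fderiv ℝ g θs‖ ≤ N * (N * M * r) :=
    fun η hη => norm_le_of_abs_apply_single_le fun j => h1 j η hη
  have hd : ∀ η ∈ Metric.closedBall θs r,
      HasFDerivWithinAt g (fderiv ℝ g η) (Metric.closedBall θs r) η := fun η hη =>
    ((hg.contDiffAt (hU.mem_nhds (hball (hsub hη)))).differentiableAt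
      (by norm_num)).hasFDerivAt.hasFDerivWithinAt
  have h3 := hconv.norm_image_sub_le_of_norm_hasFDerivWithin_le' hd h2 hc
    (y := θ) (by rw [Metric.mem_closedBall, dist_eq_norm])
  rw [Real.norm_eq_abs, fderiv_apply_eq_sum_pd] at h3
  refine h3.trans ?_
  calc N * (N * M * r) * r = r ^ 2 * (N ^ 2 * M) := by ring
    _ ≤ _ := by
      gcongr
      exact norm_le_sum_abs _

theorem pd_sum_eq_zero_of_isMaxOn {ι : Type*} {s : Finset ι} {f : ι → Param m p → ℝ}
    {Θ : Set (Param m p)} (hf : ∀ i ∈ s, DifferentiableAt ℝ (f i) θ) (hθ : θ ∈ interior Θ)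
    (hmax : IsMaxOn (fun θ => ∑ i ∈ s, f i θ) Θ θ) (k : Idx m p) :
    ∑ i ∈ s, pd k (f i) θ = 0 := by
  have h1 : IsLocalMax (fun θ => ∑ i ∈ s, f i θ) θ :=
    hmax.isLocalMax (mem_interior_iff_mem_nhds.1 hθ)
  have h2 := h1.fderiv_eq_zero
  rw [fderiv_fun_sum hf] at h2
  have h3 := congrArg (fun L : Param m p →L[ℝ] ℝ => L (EuclideanSpace.single k 1)) h2
  simpa [pd] using h3

end PartialDerivatives

/-! ### Smoothness of H, domination, and symmetry of J -/

section Smoothness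

variable {d m p : ℕ} {Ω : Type*} [MeasurableSpace Ω] {P : Measure Ω}
  {Y : Ω → ℝ} {X : Ω → Fin d → ℝ} {R : Ω → ℝ}
  {𝓜 : Model d m p} {Θ : Set (Param m p)} {θ θs : Param m p} {ξ₀ : Fin p → ℝ}

/-- Expresses π through ℓ at r = 0, so the smoothness assumed of ℓ there passes to π, hence to H,
whatever the observed r. -/
theorem Model.marginal_eq (y : ℝ) (x : Fin d → ℝ) (θ : Param m p) :
    𝓜.marginal x θ = 1 - Real.exp (𝓜.logLik (y, x, 0) θ) := by
  rw [𝓜.logLik_zero, Real.exp_log (by linarith [𝓜.marginal_lt_one x θ])]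
  ring

theorem Regularity.ae_contDiffOn_logLik (hreg : Regularity 𝓜 Θ P Y X R ξ₀ θs) :
    ∀ᵐ o ∂(obsLaw P Y X R), ContDiffOn ℝ 3 (𝓜.logLik o) (interior Θ) :=
  hreg.smooth.mono fun o ho => (ho o.2.2 (Or.inr rfl)).2.2

theorem Regularity.ae_contDiffOn_H (hreg : Regularity 𝓜 Θ P Y X R ξ₀ θs) :
    ∀ᵐ o ∂(obsLaw P Y X R), ContDiffOn ℝ 3 (𝓜.H o) (interior Θ) := by
  filter_upwards [hreg.smooth] with o ho
  have h1 := (ho 0 (Or.inl rfl)).2.2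
  have h2 : 𝓜.marginal o.2.1 = fun θ => 1 - Real.exp (𝓜.logLik (o.1, o.2.1, 0) θ) :=
    funext fun θ => 𝓜.marginal_eq _ _ _
  have h3 : ContDiffOn ℝ 3 (𝓜.marginal o.2.1) (interior Θ) := by
    rw [h2]
    exact contDiffOn_const.sub h1.exp
  unfold Model.H
  exact ((contDiffOn_const.sub h3).pow 2).sub (h3.mul (contDiffOn_const.sub h3))

theorem Regularity.ae_continuousOn_H (hreg : Regularity 𝓜 Θ P Y X R ξ₀ θs) :
    ∀ᵐ o ∂(obsLaw P Y X R), ContinuousOn (𝓜.H o) Θ := by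
  filter_upwards [hreg.smooth] with o ho
  have h1 := (ho 0 (Or.inl rfl)).2.1
  have h2 : 𝓜.marginal o.2.1 = fun θ => 1 - Real.exp (𝓜.logLik (o.1, o.2.1, 0) θ) :=
    funext fun θ => 𝓜.marginal_eq _ _ _
  have h3 : ContinuousOn (𝓜.marginal o.2.1) Θ := by
    rw [h2]
    exact continuousOn_const.sub (Real.continuous_exp.comp_continuousOn h1)
  unfold Model.H
  exact ((continuousOn_const.sub h3).pow 2).sub (h3.mul (continuousOn_const.sub h3))

/-- One integrable function dominates the higher-order partial derivatives on one ball. -/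
theorem Regularity.exists_dominating (hreg : Regularity 𝓜 Θ P Y X R ξ₀ θs) :
    ∃ ε > 0, Metric.closedBall θs ε ⊆ interior Θ ∧ ∃ M : Obs d → ℝ,
      Integrable M (obsLaw P Y X R) ∧ ∀ᵐ o ∂(obsLaw P Y X R), ∀ θ ∈ Metric.closedBall θs ε,
        ∀ i j k, |pd i (pd j (pd k (𝓜.logLik o))) θ| ≤ M o ∧ |pd i (pd j (𝓜.H o)) θ| ≤ M o := by
  choose ε hε M hM hMi using hreg.dominated
  have h1 : ∀ᶠ r in 𝓝[>] (0 : ℝ), ∀ i j k, r ≤ ε i j k :=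
    eventually_all.2 fun i => eventually_all.2 fun j => eventually_all.2 fun k =>
      mem_nhdsWithin_of_mem_nhds (Iic_mem_nhds (hε i j k))
  obtain ⟨ε₁, hε₁, hball⟩ := Metric.nhds_basis_closedBall.mem_iff.1
    (isOpen_interior.mem_nhds hreg.param_interior)
  have h2 : ∀ᶠ r in 𝓝[>] (0 : ℝ), r ≤ ε₁ := mem_nhdsWithin_of_mem_nhds (Iic_mem_nhds hε₁)
  obtain ⟨r, ⟨hr1, hr2⟩, hr0⟩ := ((h1.and h2).and self_mem_nhdsWithin).exists
  refine ⟨r, hr0, (Metric.closedBall_subset_closedBall hr2).trans hball,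
    fun o => ∑ i, ∑ j, ∑ k, |M i j k o|, integrable_finsetSum _ fun i _ =>
      integrable_finsetSum _ fun j _ => integrable_finsetSum _ fun k _ => (hMi i j k).abs, ?_⟩
  have h3 := ae_all_iff.2 fun i => ae_all_iff.2 fun j => ae_all_iff.2 fun k => hM i j k
  filter_upwards [h3] with o ho θ hθ i j k
  have hle : M i j k o ≤ ∑ i, ∑ j, ∑ k, |M i j k o| := by
    refine (le_abs_self _).trans ?_
    refine (Finset.single_le_sum (f := fun k => |M i j k o|) (fun _ _ => abs_nonneg _)
      (Finset.mem_univ k)).trans ?_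
    refine (Finset.single_le_sum (f := fun j => ∑ k, |M i j k o|)
      (fun _ _ => Finset.sum_nonneg fun _ _ => abs_nonneg _) (Finset.mem_univ j)).trans ?_
    exact Finset.single_le_sum (f := fun i => ∑ j, ∑ k, |M i j k o|)
      (fun _ _ => Finset.sum_nonneg fun _ _ => Finset.sum_nonneg fun _ _ => abs_nonneg _)
      (Finset.mem_univ i)
  have hθ' : ‖θ - θs‖ ≤ ε i j k := by
    rw [Metric.mem_closedBall, dist_eq_norm] at hθ
    exact hθ.trans (hr1 i j k)
  have := ho i j k θ hθ'
  exact ⟨this.1.trans hle, this.2.trans hle⟩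

/-- Second partials commute under the integral; this is what identifies J⁻¹h with hᵀJ⁻¹. -/
theorem Regularity.J_symm (hreg : Regularity 𝓜 Θ P Y X R ξ₀ θs) (i j : Idx m p) :
    𝓜.J (obsLaw P Y X R) θs i j = 𝓜.J (obsLaw P Y X R) θs j i := by
  unfold Model.J
  congr 1
  refine integral_congr_ae ?_
  filter_upwards [hreg.ae_contDiffOn_logLik] with o ho
  exact pd_comm isOpen_interior (ho.of_le (by norm_num)) hreg.param_interior i j

end Smoothness

/-! ### Taylor expansion of sample sums -/

section SumExpansion

variable {m p : ℕ} {U : Set (Param m p)} {θ θs : Param m p}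

theorem abs_sum_sub_sub_le {ι : Type*} {s : Finset ι} {f : ι → Param m p → ℝ} {M : ι → ℝ} {ε : ℝ}
    (hU : IsOpen U) (hf : ∀ i ∈ s, ContDiffOn ℝ 2 (f i) U) (hball : Metric.closedBall θs ε ⊆ U)
    (hM : ∀ i ∈ s, ∀ θ ∈ Metric.closedBall θs ε, ∀ j k, |pd j (pd k (f i)) θ| ≤ M i)
    (hθ : θ ∈ Metric.closedBall θs ε) :
    |∑ i ∈ s, f i θ - ∑ i ∈ s, f i θs - ∑ j, (θ - θs) j * ∑ i ∈ s, pd j (f i) θs|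
      ≤ (∑ j, |(θ - θs) j|) ^ 2 * ∑ i ∈ s, (Fintype.card (Idx m p) : ℝ) ^ 2 * M i := by
  have e : ∑ i ∈ s, f i θ - ∑ i ∈ s, f i θs - ∑ j, (θ - θs) j * ∑ i ∈ s, pd j (f i) θs
      = ∑ i ∈ s, (f i θ - f i θs - ∑ j, (θ - θs) j * pd j (f i) θs) := by
    simp only [Finset.sum_sub_distrib, Finset.mul_sum]
    rw [Finset.sum_comm]
  rw [e, Finset.mul_sum]
  exact (Finset.abs_sum_le_sum_abs _ _).trans (Finset.sum_le_sum fun i hi =>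
    abs_sub_sub_sum_pd_le hU (hf i hi) hball (hM i hi) hθ)

end SumExpansion

/-! ### Measurability of a process at a random parameter -/

section Caratheodory

variable {Ω E : Type*} [MeasurableSpace Ω] {P : Measure Ω} [PseudoMetricSpace E]
  [SecondCountableTopology E] [MeasurableSpace E] [OpensMeasurableSpace E]

/-- A process with measurable coordinates and almost surely continuous paths, evaluated at a random
parameter, is measurable. -/
theorem aemeasurable_eval_of_continuousOn {G : E → Ω → ℝ} {Θ : Set E} {θ : Ω → E} {θs : E}
    (hG : ∀ θ ∈ Θ, AEMeasurable (G θ) P) (hc : ∀ᵐ ω ∂P, ContinuousOn (fun θ => G θ ω) Θ)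
    (hθ : AEMeasurable θ P) (hmem : ∀ᵐ ω ∂P, θ ω ∈ Θ) (hθs : θs ∈ Θ) :
    AEMeasurable (fun ω => G (θ ω) ω) P := by
  classical
  let a : ℕ → SimpleFunc Ω E := SimpleFunc.approxOn (hθ.mk θ) hθ.measurable_mk Θ θs hθs
  have ha : ∀ n ω, a n ω ∈ Θ := fun n ω => SimpleFunc.approxOn_mem _ hθs n ω
  refine aemeasurable_of_tendsto_metrizable_ae atTop (f := fun n ω => G (a n ω) ω) (fun n => ?_) ?_
  -- A simple function takes finitely many values, so only finitely many null sets arise when each G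
  -- θ is replaced by a measurable version.
  · let G' : E → Ω → ℝ := fun θ => if h : θ ∈ Θ then (hG θ h).mk (G θ) else 0
    have hG' : ∀ θ, Measurable (G' θ) := fun θ => by
      by_cases h : θ ∈ Θ
      · simp only [G', dif_pos h]; exact (hG θ h).measurable_mk
      · simp only [G', dif_neg h]; exact measurable_const
    have heq : ∀ᵐ ω ∂P, ∀ θ ∈ (a n).range, θ ∈ Θ → G θ ω = G' θ ω := by
      refine (Finset.eventually_all _).2 fun θ _ => ?_
      by_cases h : θ ∈ Θ
      · filter_upwards [(hG θ h).ae_eq_mk] with ω hω _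
        simp only [G', dif_pos h]
        exact hω
      · exact ae_of_all _ fun ω h' => absurd h' h
    refine ⟨fun ω => G' (a n ω) ω, (a n).measurable_bind G' hG', ?_⟩
    filter_upwards [heq] with ω hω
    exact hω _ (SimpleFunc.mem_range_self _ _) (ha n ω)
  · filter_upwards [hc, hmem, hθ.ae_eq_mk] with ω h1 h2 h3
    have h4 : Tendsto (fun n => a n ω) atTop (𝓝 (θ ω)) := by
      rw [h3]
      exact SimpleFunc.tendsto_approxOn _ hθs (subset_closure (h3 ▸ h2))
    exact (h1 (θ ω) h2).tendsto.comp
      (tendsto_nhdsWithin_iff.2 ⟨h4, Eventually.of_forall fun n => ha n ω⟩)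

end Caratheodory

/-! ### The variance of the influence function -/

section Variance

open Matrix

theorem variance_sum_mul {Ω κ : Type*} [MeasurableSpace Ω] [Fintype κ] {Q : Measure Ω}
    [IsFiniteMeasure Q] {Z : κ → Ω → ℝ} (hZ : ∀ a, MemLp (Z a) 2 Q) (c : κ → ℝ) :
    Var[fun ω => ∑ a, c a * Z a ω; Q]
      = c ⬝ᵥ (Matrix.of fun a b => covariance (Z a) (Z b) Q) *ᵥ c := by
  have hm := memLp_finsetSum Finset.univ fun a (_ : a ∈ Finset.univ) => (hZ a).const_mul (c a)
  rw [← covariance_self hm.1.aemeasurable,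
    covariance_fun_sum_fun_sum (fun a => (hZ a).const_mul (c a)) fun a => (hZ a).const_mul (c a)]
  simp only [covariance_const_mul_left, covariance_const_mul_right, dotProduct, Matrix.mulVec,
    Finset.mul_sum, Matrix.of_apply]
  refine Finset.sum_congr rfl fun a _ => Finset.sum_congr rfl fun b _ => ?_
  ring

variable {d m p : ℕ} {Ω : Type*} [MeasurableSpace Ω] {P : Measure Ω}
  {Y : Ω → ℝ} {X : Ω → Fin d → ℝ} {R : Ω → ℝ}
  {𝓜 : Model d m p} {Θ : Set (Param m p)} {θs : Param m p} {ξ₀ : Fin p → ℝ}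

theorem Regularity.variance_eq_sigmaSq (hreg : Regularity 𝓜 Θ P Y X R ξ₀ θs)
    [IsFiniteMeasure (obsLaw P Y X R)] :
    Var[fun o => 𝓜.H o θs + ∑ k, ((𝓜.J (obsLaw P Y X R) θs)⁻¹ *ᵥ 𝓜.h (obsLaw P Y X R) θs) k
      * pd k (𝓜.logLik o) θs; obsLaw P Y X R] = 𝓜.sigmaSq (obsLaw P Y X R) θs := by
  set J := 𝓜.J (obsLaw P Y X R) θs with hJ
  have hsymm : Jᵀ = J := by
    ext i j
    exact hreg.J_symm j i
  have h1 : J⁻¹ *ᵥ 𝓜.h (obsLaw P Y X R) θs = 𝓜.h (obsLaw P Y X R) θs ᵥ* J⁻¹ := by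
    rw [← Matrix.vecMul_transpose, Matrix.transpose_nonsing_inv, hsymm]
  have h2 := variance_sum_mul hreg.Sig_exists (𝓜.influence (obsLaw P Y X R) θs)
  rw [h1]
  refine Eq.trans ?_ h2
  congr 1
  funext o
  simp [Fintype.sum_sum_type, Model.influence, Model.Z, ← hJ]

end Variance

end NonignorableGOF

/-! ### Consistency, expansions and limit law combined -/

theorem theorem1 {d m p : ℕ} {Ω : Type*} [MeasurableSpace Ω]
    (P : MeasureTheory.Measure Ω) [MeasureTheory.IsProbabilityMeasure P]
    (𝓜 : NonignorableGOF.Model d m p) (Θ : Set (NonignorableGOF.Param m p))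
    -- the population variables
    (Y : Ω → ℝ) (X : Ω → Fin d → ℝ) (R : Ω → ℝ)
    (hY : Measurable Y) (hX : Measurable X) (hR : Measurable R)
    (hR01 : ∀ ω, R ω = 0 ∨ R ω = 1)
    (hdef : NonignorableGOF.WellDefined 𝓜 Θ (NonignorableGOF.obsLaw P Y X R))
    -- the instrument and identifiability under the null model
    (hA1 : NonignorableGOF.Assumption1 𝓜 Θ P Y X R)
    -- the outcome model for the observed units
    (ξ₀ : Fin p → ℝ) (hA2 : 𝓜.IsOutcomeDensity P Y X R ξ₀)
    -- the (pseudo-)true value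
    (θs : NonignorableGOF.Param m p)
    (hθs : IsMaxOn (𝓜.expLogLik (NonignorableGOF.obsLaw P Y X R)) Θ θs)
    (hreg : NonignorableGOF.Regularity 𝓜 Θ P Y X R ξ₀ θs)
    -- the i.i.d. observations `(R_i Y_i, X_i, R_i)`
    (Ys : ℕ → Ω → ℝ) (Xs : ℕ → Ω → Fin d → ℝ) (Rs : ℕ → Ω → ℝ)
    (hindep : ProbabilityTheory.iIndepFun
      (fun i ω => ((Rs i ω * Ys i ω, Xs i ω, Rs i ω) : NonignorableGOF.Obs d)) P)
    (hident : ∀ i, ProbabilityTheory.IdentDistrib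
      (fun ω => ((Rs i ω * Ys i ω, Xs i ω, Rs i ω) : NonignorableGOF.Obs d))
      (fun ω => ((R ω * Y ω, X ω, R ω) : NonignorableGOF.Obs d)) P P)
    -- the quasi-maximum likelihood estimator
    (θhat : ℕ → Ω → NonignorableGOF.Param m p)
    (hθhat_meas : ∀ n, AEMeasurable (θhat n) P)
    (hθhat : ∀ n, ∀ᵐ ω ∂P, θhat n ω ∈ Θ ∧
      IsMaxOn (𝓜.logLikSum (fun i => (Rs i ω * Ys i ω, Xs i ω, Rs i ω)) n) Θ (θhat n ω)) :
    MeasureTheory.TendstoInDistribution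
      (fun n ω => 𝓜.T (fun i => (Rs i ω * Ys i ω, Xs i ω, Rs i ω)) n (θhat n ω)
        - Real.sqrt n * 𝓜.Delta (NonignorableGOF.obsLaw P Y X R) θs)
      Filter.atTop (id : ℝ → ℝ) (fun _ => P)
      (ProbabilityTheory.gaussianReal 0
        (𝓜.sigmaSq (NonignorableGOF.obsLaw P Y X R) θs).toNNReal) := by
  set ξ : ℕ → Ω → NonignorableGOF.Obs d := fun i ω => (Rs i ω * Ys i ω, Xs i ω, Rs i ω) with hξdef
  set Q := NonignorableGOF.obsLaw P Y X R with hQ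
  have hξ : NonignorableGOF.IsSample P Q ξ :=
    ⟨hindep, fun i => (hident i).aemeasurable_fst, fun i => (hident i).map_eq⟩
  have hQp : IsProbabilityMeasure Q := MeasureTheory.Measure.isProbabilityMeasure_map (by fun_prop)
  have hmem : θs ∈ Θ := interior_subset hreg.param_interior
  -- consistency
  obtain ⟨his, huniq⟩ := hreg.integrable_and_unique_max hdef hA1 hA2 hθs hY hX hR hR01
  have hcons : ∀ᵐ ω ∂P, Tendsto (fun n => θhat n ω) atTop (𝓝 θs) := by
    refine hξ.tendsto_of_isMaxOn hreg.param_compact hmem his (fun θ hθ hne => ?_) hθhat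
    obtain ⟨ρ, hρ, B, hB, hle⟩ := hreg.exists_integrable_local_bound hY hX hR hR01 hθ
    exact NonignorableGOF.exists_local_majorant hθ
      (fun θ _ => (𝓜.measurable_logLik θ).aemeasurable) hreg.ae_continuousOn hρ hB hle
      (huniq θ hθ hne)
  -- expansions
  obtain ⟨ε, hε, hball, M, hM, hdom⟩ := hreg.exists_dominating
  have hS : ∀ n, AEMeasurable (fun ω => ∑ i ∈ Finset.range n, 𝓜.H (ξ i ω) (θhat n ω)) P := by
    intro n
    refine NonignorableGOF.aemeasurable_eval_of_continuousOn (Θ := Θ)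
      (G := fun θ ω => ∑ i ∈ Finset.range n, 𝓜.H (ξ i ω) θ) (fun θ _ => ?_) ?_
      (hθhat_meas n) ((hθhat n).mono fun ω hω => hω.1) hmem
    · exact Finset.aemeasurable_fun_sum _ fun i _ =>
        hξ.aemeasurable_comp (𝓜.measurable_H θ).aemeasurable i
    · filter_upwards [hξ.ae hreg.ae_continuousOn_H] with ω hω
      exact continuousOn_finsetSum _ fun i _ => hω i
  have hnear : ∀ᵐ ω ∂P, ∀ᶠ n in atTop, θhat n ω ∈ Metric.closedBall θs ε := by
    filter_upwards [hcons] with ω hω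
    exact hω.eventually (Metric.closedBall_mem_nhds θs hε)
  have hmain := hξ.tendstoInDistribution_plugin
    (ψ := fun k o => NonignorableGOF.pd k (𝓜.logLik o) θs)
    (B := fun j k o => NonignorableGOF.pd j (NonignorableGOF.pd k (𝓜.logLik o)) θs)
    (H := fun o => 𝓜.H o θs)
    (M := fun o => (Fintype.card (NonignorableGOF.Idx m p) : ℝ) ^ 2 * M o)
    (h := fun j o => NonignorableGOF.pd j (𝓜.H o) θs)
    (V := fun j n ω => (θhat n ω - θs) j)
    (J := 𝓜.J Q θs)
    (fun k => hreg.Sig_exists (Sum.inr k)) (hreg.Sig_exists (Sum.inl ()))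
    hreg.J_exists hreg.h_exists (hM.const_mul _) (fun _ _ => rfl) hreg.J_full_rank hS ?_ ?_ ?_
  · have := hmain.2
    rw [show (fun j => ∫ o, NonignorableGOF.pd j (𝓜.H o) θs ∂Q) = 𝓜.h Q θs from rfl,
      hreg.variance_eq_sigmaSq] at this
    exact this
  · filter_upwards [hcons] with ω hω j
    have h1 : Continuous fun θ : NonignorableGOF.Param m p => (θ - θs) j := by fun_prop
    have h2 := (h1.tendsto θs).comp hω
    rw [sub_self] at h2
    exact h2
  · filter_upwards [hnear, hξ.ae hreg.ae_contDiffOn_logLik, hξ.ae hdom, ae_all_iff.2 hθhat]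
      with ω h1 h2 h3 h4
    filter_upwards [h1] with n hn k
    -- The expanded functions are the k-th scores; their second partials are the dominated third
    -- derivatives of ℓ. By `h6` the total score vanishes at the estimator.
    have h5 := NonignorableGOF.abs_sum_sub_sub_le (s := Finset.range n)
      (f := fun i => NonignorableGOF.pd k (𝓜.logLik (ξ i ω))) (M := fun i => M (ξ i ω))
      isOpen_interior
      (fun i _ => NonignorableGOF.contDiffOn_pd (n := 2) isOpen_interior
        ((h2 i).of_le (by norm_num)) k) hball
      (fun i _ θ hθ j l => (h3 i θ hθ j l k).1) hn
    have h6 := NonignorableGOF.pd_sum_eq_zero_of_isMaxOn (s := Finset.range n)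
      (f := fun i => 𝓜.logLik (ξ i ω))
      (fun i _ => ((h2 i).contDiffAt (isOpen_interior.mem_nhds (hball hn))).differentiableAt
        (by norm_num)) (hball hn) (h4 n).2 k
    rw [h6, zero_sub, ← neg_add', abs_neg] at h5
    exact h5
  · filter_upwards [hnear, hξ.ae hreg.ae_contDiffOn_H, hξ.ae hdom] with ω h1 h2 h3
    filter_upwards [h1] with n hn
    exact NonignorableGOF.abs_sum_sub_sub_le (s := Finset.range n)
      (f := fun i => 𝓜.H (ξ i ω)) (M := fun i => M (ξ i ω)) isOpen_interior
      (fun i _ => (h2 i).of_le (by norm_num)) hball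
      -- The bound on H does not involve the third index, so repeating k is harmless.
      (fun i _ θ hθ j k => (h3 i θ hθ j k k).2) hn
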